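/- For $n\ge 0$ let $$p_n[\sin](z)=\sum_{k=0}^{\lfloor (n-1)/2\rfloor}\frac{(-1)^k z^{2k+1}}{(2k+1)!}$$ denote the $n$-th partial sum of the Maclaurin series of $\sin z$, and let $$S=\{z\in\mathbb C:\ |z e^{1-z}|=1,\ |z|\le 1,\ \operatorname{Re} z>0\}$$ be the part of the Szegő curve in the right half-plane. Call $z_0\in\mathbb C$ a limit point of the zeros of a sequence of functions if every neighbourhood of $z_0$ contains a zero of the $n$-th function for infinitely many $n$. (a) The limit points of the zeros of the scaled partial sums $p_{n-1}[\sin](nz)$ which do not lie on the real axis are precisely the points of $iS\cup -iS$. (b) Let $\xi\in S$, $\xi\ne 1$. Put $\tau=\operatorname{Im}(\xi-1-\log\xi)$ (principal logarithm), let $\tau_n\equiv\tau n \pmod{2\pi}$ with $-\pi<\tau_n\le\pi$, and let $$z_n(w)=\xi\left(1+\frac{\log n}{2(1-\xi)n}-\frac{w-i\tau_n}{(1-\xi)n}\right).$$ Then, for each choice of the sign $\pm$ (the same in the numerator and the denominator), $$\frac{p_{n-1}[\sin](\pm i n z_n(w))}{\sin(\pm i n z_n(w))}=1-\left(\frac1{1-\xi}-\frac{(-1)^n}{1+\xi}\right)\frac{e^{-w}}{\sqrt{2\pi}}+o(1)$$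 as $n\to\infty$, uniformly for $w$ in compact subsets of $\mathbb C$. (c) For each choice of the sign $\pm$ (the same in the numerator and the denominator), $$\lim_{n\to\infty}\frac{p_{n-1}[\sin](\pm i(n+w\sqrt n))}{\sin(\pm i(n+w\sqrt n))}=\frac12\operatorname{erfc}\left(\frac{w}{\sqrt2}\right)$$ uniformly for $w$ in compact subsets of $\{\operatorname{Re} w<0\}$, where $\operatorname{erfc}(z)=\frac{2}{\sqrt\pi}\int_z^{z+\infty}e^{-s^2}\,ds$, integrated along the horizontal ray from $z$ to the right. -/

import Mathlib

/-- The `n`-th partial sum of the Maclaurin series of `sin`: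
`∑_{k=0}^{⌊(n-1)/2⌋} (-1)^k z^(2k+1) / (2k+1)!`, all the terms of degree at most `n`.
(The index set `k < (n+1)/2` is `0 ≤ k ≤ ⌊(n-1)/2⌋`; it is empty for `n = 0`.) -/
noncomputable def sinPartialSum (n : ℕ) (z : ℂ) : ℂ :=
  ∑ k ∈ Finset.range ((n + 1) / 2), (-1 : ℂ) ^ k * z ^ (2 * k + 1) / ((2 * k + 1).factorial : ℂ)

/-- The part `S` of the Szegő curve in the open right half-plane. -/
def szegoCurveRight : Set ℂ :=
  {z : ℂ | ‖z * Complex.exp (1 - z)‖ = 1 ∧ ‖z‖ ≤ 1 ∧ 0 < z.re}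

/-- `z₀` is a limit point of the zeros of the sequence of functions `g`: every neighbourhood
of `z₀` contains a zero of `g n` for infinitely many `n`. -/
def IsLimitPointOfZeros (g : ℕ → ℂ → ℂ) (z₀ : ℂ) : Prop :=
  ∀ ε : ℝ, 0 < ε → ∃ᶠ n in Filter.atTop, ∃ z : ℂ, g n z = 0 ∧ dist z z₀ < ε

/-- The complementary error function `(2/√π) ∫_z^{z+∞} exp(-s²) ds`, the integral being along
the horizontal ray `s = z + t`, `t > 0`. -/
noncomputable def complexErfc (z : ℂ) : ℂ :=
  2 / (Real.sqrt Real.pi : ℂ) * ∫ t in Set.Ioi (0 : ℝ), Complex.exp (-(z + (t : ℂ)) ^ 2)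

/-- `τ = Im (ξ - 1 - log ξ)`, with the principal logarithm. -/
noncomputable def arcTau (ξ : ℂ) : ℝ := (ξ - 1 - Complex.log ξ).im

/-- `τ_n`, the representative of `τ n` modulo `2π` in the interval `(-π, π]`. -/
noncomputable def arcTauN (ξ : ℂ) (n : ℕ) : ℝ :=
  toIocMod Real.two_pi_pos (-Real.pi) (arcTau ξ * n)

/-- `z_n(w) = ξ (1 + log n / (2 (1 - ξ) n) - (w - i τ_n) / ((1 - ξ) n))`. -/
noncomputable def arcPoint (ξ : ℂ) (n : ℕ) (w : ℂ) : ℂ :=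
  ξ * (1 + (Real.log n : ℂ) / (2 * (1 - ξ) * n)
    - (w - Complex.I * (arcTauN ξ n : ℂ)) / ((1 - ξ) * n))

/-! On the imaginary axis sine becomes sinh, so its partial sum at `±ix` is, up to a factor, `E(x) -
E(-x)` with `E` the exponential sum of degree below `n`. Put `x = nζ` and multiply by `exp (-x)`.
The integral form of the remainder of `exp` gives `1 - exp (-2x) - s_n (ζ e^(1-ζ))^n T_n(ζ)`, where
`s_n = n^n e^(-n) / n! ~ 1/√(2πn)` and `T_n` combines the tail integrals at `ζ` and `-ζ`
(`normalizedOddPart_eq`). For `|Re ζ| < 1` the difference between `T_n` and `1/(1-ζ) - (-1)^n/(1+ζ)`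
tends to 0.

If `Re ζ > 0`, zeros need the last product to be close to 1, which forces `|ζ e^(1-ζ)| = 1` in the
limit; Eneström–Kakeya gives `|ζ| ≤ 1`. Conversely, `z_n(w)` is chosen so that `(z_n e^(1-z_n))^n ~
√n e^(-w)`. This yields the arc limit, and Hurwitz's theorem then produces zeros near each point of
the curve other than 1.

At the corner `ζ = 1` the tail integral lives on the scale `√n` instead of `n` and becomes Gaussian,
whence `erfc`.

The limits are proved along a general filter: `atTop ×ˢ 𝓝 w₀` yields local uniformity, and its
restriction to the zero set yields the accumulation statement. -/

open Filter Topology MeasureTheory Set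

/-! ### Integral form of the exponential remainder -/

/-- The sum of the terms of degree less than `n` of the exponential series. -/
noncomputable def expPartialSum (n : ℕ) (x : ℂ) : ℂ :=
  ∑ k ∈ Finset.range n, x ^ k / (k.factorial : ℂ)

/-- The integral `∫_0^a (1 - t/a)^(n-1) e^(x t/a) dt`, which represents the remainder of the
exponential series. -/
noncomputable def expTailIntegral (n : ℕ) (a : ℝ) (x : ℂ) : ℂ :=
  ∫ t in Ioi (0 : ℝ), (Iic a).indicator
    (fun t : ℝ => (1 - (t : ℂ) / a) ^ (n - 1) * Complex.exp (x * t / a)) t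

theorem expPartialSum_succ (n : ℕ) (x : ℂ) :
    expPartialSum (n + 1) x = expPartialSum n x + x ^ n / (n.factorial : ℂ) :=
  Finset.sum_range_succ _ _

/-- Integration by parts: the derivative of `s^(n+1) exp (x (1 - s))` is integrated over `[0, 1]`.
-/
theorem integral_pow_mul_exp_recurrence (n : ℕ) (x : ℂ) :
    x * ∫ s in (0 : ℝ)..1, (s : ℂ) ^ (n + 1) * Complex.exp (x * (1 - s)) =
      (n + 1) * (∫ s in (0 : ℝ)..1, (s : ℂ) ^ n * Complex.exp (x * (1 - s))) - 1 := by
  have hd : ∀ s : ℝ, HasDerivAt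
      (fun s : ℝ => (s : ℂ) ^ (n + 1) * Complex.exp (x * (1 - s)))
      ((n + 1) * ((s : ℂ) ^ n * Complex.exp (x * (1 - s))) -
        x * ((s : ℂ) ^ (n + 1) * Complex.exp (x * (1 - s)))) s := by
    intro s
    have h : HasDerivAt (fun s : ℂ => s ^ (n + 1) * Complex.exp (x * (1 - s))) _ (s : ℂ) :=
      (hasDerivAt_pow (n + 1) (s : ℂ)).mul
        ((((hasDerivAt_id (s : ℂ)).const_sub 1).const_mul x).cexp)
    convert h.comp_ofReal using 1
    push_cast
    simp
    ring
  have h := intervalIntegral.integral_eq_sub_of_hasDerivAt (a := 0) (b := 1)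
    (fun s _ => hd s) (Continuous.intervalIntegrable (by fun_prop) _ _)
  rw [intervalIntegral.integral_sub (Continuous.intervalIntegrable (by fun_prop) _ _)
    (Continuous.intervalIntegrable (by fun_prop) _ _), intervalIntegral.integral_const_mul,
    intervalIntegral.integral_const_mul] at h
  simp at h
  linear_combination -h

theorem factorial_mul_exp_sub_expPartialSum (n : ℕ) (x : ℂ) :
    (n.factorial : ℂ) * (Complex.exp x - expPartialSum (n + 1) x) =
      x ^ (n + 1) * ∫ s in (0 : ℝ)..1, (s : ℂ) ^ n * Complex.exp (x * (1 - s)) := by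
  induction n with
  | zero =>
    have hd : ∀ s : ℝ, HasDerivAt (fun s : ℝ => Complex.exp (x * (1 - s)))
        (-(x * Complex.exp (x * (1 - s)))) s := by
      intro s
      have h : HasDerivAt (fun s : ℂ => Complex.exp (x * (1 - s))) _ (s : ℂ) :=
        (((hasDerivAt_id (s : ℂ)).const_sub 1).const_mul x).cexp
      convert h.comp_ofReal using 1
      simp
      ring
    have h := intervalIntegral.integral_eq_sub_of_hasDerivAt (a := 0) (b := 1)
      (fun s _ => hd s) (Continuous.intervalIntegrable (by fun_prop) _ _)
    rw [intervalIntegral.integral_neg, intervalIntegral.integral_const_mul] at h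
    simp at h
    simp [expPartialSum]
    linear_combination h
  | succ n ih =>
    have h := integral_pow_mul_exp_recurrence n x
    rw [pow_succ x (n + 1), mul_assoc, h, expPartialSum_succ, Nat.factorial_succ]
    push_cast
    have : (n.factorial : ℂ) ≠ 0 := by exact_mod_cast n.factorial_ne_zero
    have : (n + 1 : ℂ) ≠ 0 := by exact_mod_cast n.succ_ne_zero
    field_simp
    linear_combination (n + 1 : ℂ) * ih

/-- Substitution `s = 1 - t/a` in Taylor's remainder. The scale `a` stays free because it is taken
to be `n` away from `ζ = 1` and `√n` near it. -/
theorem exp_sub_expPartialSum {n : ℕ} (hn : 1 ≤ n) {a : ℝ} (ha : 0 < a) (x : ℂ) :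
    Complex.exp x - expPartialSum n x =
      x ^ n / (n.factorial : ℂ) * ((n : ℂ) / a) * expTailIntegral n a x := by
  obtain ⟨n, rfl⟩ := Nat.exists_eq_add_of_le' hn
  have h1 : expTailIntegral (n + 1) a x =
      a * ∫ s in (0 : ℝ)..1, (s : ℂ) ^ n * Complex.exp (x * (1 - s)) := by
    have h := intervalIntegral.integral_comp_sub_div (a := 0) (b := a)
      (fun s : ℝ => (s : ℂ) ^ n * Complex.exp (x * (1 - s))) ha.ne' 1
    rw [expTailIntegral, setIntegral_indicator measurableSet_Iic, Ioi_inter_Iic,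
      ← intervalIntegral.integral_of_le ha.le]
    simp [ha.ne'] at h
    rw [← h]
    simp [mul_div_assoc]
  have h2 := factorial_mul_exp_sub_expPartialSum n x
  have : (n.factorial : ℂ) ≠ 0 := by exact_mod_cast n.factorial_ne_zero
  have : (n + 1 : ℂ) ≠ 0 := by exact_mod_cast n.succ_ne_zero
  have : (a : ℂ) ≠ 0 := by exact_mod_cast ha.ne'
  rw [h1, Nat.factorial_succ]
  push_cast
  field_simp
  linear_combination h2

/-! ### Asymptotics of powers and of Stirling's quotient -/

section Limits

variable {ι : Type*} {l : Filter ι} {n : ι → ℕ}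

theorem tendsto_zero_of_sqrt_mul {v : ι → ℂ} {b : ℂ} (hn : Tendsto n l atTop)
    (hv : Tendsto (fun i => (Real.sqrt (n i) : ℂ) * v i) l (𝓝 b)) : Tendsto v l (𝓝 0) := by
  have h1 : Tendsto (fun i => ((Real.sqrt (n i))⁻¹ : ℝ)) l (𝓝 0) :=
    tendsto_inv_atTop_zero.comp (Real.tendsto_sqrt_atTop.comp (tendsto_natCast_atTop_atTop.comp hn))
  have h2 : Tendsto (fun i => (((Real.sqrt (n i))⁻¹ : ℝ) : ℂ)) l (𝓝 0) := by
    exact_mod_cast (Complex.continuous_ofReal.tendsto 0).comp h1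
  have h3 := h2.mul hv
  rw [zero_mul] at h3
  refine h3.congr' ?_
  filter_upwards [hn.eventually_ge_atTop 1] with i hi
  have : (Real.sqrt (n i) : ℂ) ≠ 0 := by
    have : (0 : ℝ) < n i := by exact_mod_cast hi
    exact_mod_cast (Real.sqrt_pos.2 this).ne'
  push_cast
  field_simp

/-- `n (log (1 + v) - v) = -n v²/2 + O(n v³)`, and the error vanishes because `√n v` converges while
`v → 0`. -/
theorem tendsto_one_add_pow_mul_exp {v : ι → ℂ} {b : ℂ} (hn : Tendsto n l atTop)
    (hv : Tendsto (fun i => (Real.sqrt (n i) : ℂ) * v i) l (𝓝 b)) :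
    Tendsto (fun i => (1 + v i) ^ n i * Complex.exp (-(n i * v i))) l
      (𝓝 (Complex.exp (-(b ^ 2 / 2)))) := by
  have hv0 := tendsto_zero_of_sqrt_mul hn hv
  have hsq : ∀ i, ((Real.sqrt (n i) : ℂ)) ^ 2 = n i := fun i => by
    exact_mod_cast congrArg Complex.ofReal (Real.sq_sqrt (Nat.cast_nonneg (n i)))
  have hO := (Complex.log_sub_logTaylor_isBigO 2).comp_tendsto hv0
  have hlim : Tendsto (fun i => (n i : ℂ) *
      (Complex.log (1 + v i) - Complex.logTaylor 3 (v i))) l (𝓝 0) := by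
    have h1 : Tendsto (fun i => ((Real.sqrt (n i) : ℂ) * v i) ^ 2 * v i) l (𝓝 0) := by
      simpa using (hv.pow 2).mul hv0
    refine Asymptotics.IsBigO.trans_tendsto ?_ h1
    refine ((Asymptotics.isBigO_refl (fun i => (n i : ℂ)) l).mul hO).congr (fun _ => rfl) ?_
    intro i
    simp only [Function.comp]
    rw [mul_pow, hsq]
    ring
  have h2 : Tendsto (fun i => (n i : ℂ) *
      (Complex.log (1 + v i) - Complex.logTaylor 3 (v i)) -
        ((Real.sqrt (n i) : ℂ) * v i) ^ 2 / 2) l (𝓝 (0 - b ^ 2 / 2)) :=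
    hlim.sub ((hv.pow 2).div_const 2)
  rw [zero_sub] at h2
  refine ((Complex.continuous_exp.tendsto _).comp h2).congr' ?_
  have hne : ∀ᶠ i in l, 1 + v i ≠ 0 := by
    have : Tendsto (fun i => 1 + v i) l (𝓝 (1 + 0)) := hv0.const_add 1
    exact this.eventually_ne (by simp)
  filter_upwards [hne] with i hi
  simp only [Function.comp]
  rw [mul_pow, hsq]
  conv_rhs => rw [← Complex.exp_log hi]
  rw [← Complex.exp_nat_mul, ← Complex.exp_add]
  congr 1
  simp only [Complex.logTaylor_succ, Complex.logTaylor_zero, Pi.add_apply]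
  push_cast
  ring

theorem tendsto_sqrt_mul_pow_div_factorial (hn : Tendsto n l atTop) :
    Tendsto (fun i => (Real.sqrt (n i) : ℂ) * ((n i : ℂ) ^ n i * Complex.exp (-n i) /
      ((n i).factorial : ℂ))) l (𝓝 (1 / (Real.sqrt (2 * Real.pi) : ℂ))) := by
  have h1 : Tendsto (fun m : ℕ => 1 / (Real.sqrt 2 * Stirling.stirlingSeq m)) atTop
      (𝓝 (1 / (Real.sqrt 2 * Real.sqrt Real.pi))) :=
    tendsto_const_nhds.div (Stirling.tendsto_stirlingSeq_sqrt_pi.const_mul _) (by positivity)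
  have h2 := (Complex.continuous_ofReal.tendsto _).comp (h1.comp hn)
  rw [← Real.sqrt_mul zero_le_two] at h2
  push_cast at h2
  refine h2.congr' ?_
  filter_upwards [hn.eventually_ge_atTop 1] with i hi
  have h0 : (0 : ℝ) < n i := by exact_mod_cast hi
  have : 1 / (Real.sqrt 2 * Stirling.stirlingSeq (n i)) =
      Real.sqrt (n i) * ((n i : ℝ) ^ n i * Real.exp (-n i) / ((n i).factorial : ℝ)) := by
    rw [Stirling.stirlingSeq, Real.sqrt_mul zero_le_two, div_pow, ← Real.exp_nat_mul, mul_one,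
      Real.exp_neg]
    have := Real.sqrt_pos.2 h0
    have h4 : Real.sqrt 2 * Real.sqrt 2 = 2 := Real.mul_self_sqrt zero_le_two
    have : ((n i).factorial : ℝ) ≠ 0 := by exact_mod_cast (n i).factorial_ne_zero
    field_simp
  simp only [Function.comp]
  rw [this]
  push_cast
  rfl

end Limits

/-! ### Limits of the tail integrals -/

section TailLimits

variable {ι : Type*} {l : Filter ι} {n : ι → ℕ}

/-- Follows from `1 - u ≤ exp (-u)`. The extra `1/a` pays for the exponent `n - 1` in place of `n`.
-/
theorem norm_expTail_integrand_le {n : ℕ} (hn : 1 ≤ n) {a t b : ℝ} (ha : 0 < a) (ht : 0 < t)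
    {x : ℂ} (hb : ((x - n) / a).re + 1 / a ≤ b) :
    ‖(Iic a).indicator (fun t : ℝ => (1 - (t : ℂ) / a) ^ (n - 1) * Complex.exp (x * t / a)) t‖ ≤
      Real.exp (b * t) := by
  by_cases hta : t ≤ a
  · rw [indicator_of_mem (by exact hta), norm_mul, norm_pow, Complex.norm_exp]
    have h1 : ‖1 - (t : ℂ) / a‖ = 1 - t / a := by
      rw [← Complex.ofReal_div, ← Complex.ofReal_one, ← Complex.ofReal_sub, Complex.norm_real,
        Real.norm_of_nonneg (sub_nonneg.2 ((div_le_one ha).2 hta))]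
    have h2 : (1 - t / a) ^ (n - 1) ≤ Real.exp (((n - 1 : ℕ) : ℝ) * (-(t / a))) := by
      rw [Real.exp_nat_mul]
      exact pow_le_pow_left₀ (sub_nonneg.2 ((div_le_one ha).2 hta))
        (by linarith [Real.add_one_le_exp (-(t / a))]) _
    rw [h1]
    refine (mul_le_mul_of_nonneg_right h2 (Real.exp_pos _).le).trans ?_
    rw [← Real.exp_add, Real.exp_le_exp, Nat.cast_sub hn]
    have h3 : (x * t / a).re = x.re * t / a := by
      rw [Complex.div_ofReal_re, Complex.re_mul_ofReal]
    have h4 : ((x - n) / a).re = (x.re - n) / a := by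
      rw [Complex.div_ofReal_re, Complex.sub_re, Complex.natCast_re]
    rw [h4] at hb
    rw [h3]
    calc _ = ((x.re - n) / a + 1 / a) * t := by push_cast; ring
      _ ≤ _ := mul_le_mul_of_nonneg_right hb ht.le
  · rw [indicator_of_notMem (by exact hta), norm_zero]
    exact (Real.exp_pos _).le

/-- The integrand is `(1 - t/a)^n e^(nt/a)`, which tends to `exp (-(ct)²/2)`, times `e^((x-n)t/a) /
(1 - t/a)`. The constant `c` is 0 on the scale `a = n` and 1 on the scale `a = √n`. -/
theorem tendsto_expTail_integrand {a : ι → ℝ} {x : ι → ℂ} {c : ℝ} {w : ℂ}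
    (hn : Tendsto n l atTop) (ha : Tendsto a l atTop)
    (hc : Tendsto (fun i => Real.sqrt (n i) / a i) l (𝓝 c))
    (hx : Tendsto (fun i => (x i - n i) / a i) l (𝓝 w)) (t : ℝ) :
    Tendsto (fun i => (Iic (a i)).indicator
      (fun t : ℝ => (1 - (t : ℂ) / a i) ^ (n i - 1) * Complex.exp (x i * t / a i)) t) l
      (𝓝 (Complex.exp (-((c * t : ℂ) ^ 2 / 2) + w * t))) := by
  have hv : Tendsto (fun i => (Real.sqrt (n i) : ℂ) * (-(t / a i))) l (𝓝 (-(c * t))) := by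
    have h := (((Complex.continuous_ofReal.tendsto _).comp hc).mul_const (t : ℂ)).neg
    refine h.congr fun i => ?_
    simp only [Function.comp]
    push_cast
    ring
  have h1 := tendsto_one_add_pow_mul_exp hn hv
  have h2 := (tendsto_zero_of_sqrt_mul hn hv).const_add 1
  have h3 := (Complex.continuous_exp.tendsto _).comp (hx.mul_const (t : ℂ))
  have h4 := (h1.mul h3).div h2 (by simp)
  rw [neg_sq, ← Complex.exp_add, add_zero, div_one] at h4
  refine h4.congr' ?_
  filter_upwards [ha.eventually_gt_atTop (max t 0), hn.eventually_ge_atTop 1,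
    h2.eventually_ne (by simp : (1 + 0 : ℂ) ≠ 0)] with i hi hi1 hi2
  rw [indicator_of_mem (by exact (lt_of_le_of_lt (le_max_left _ _) hi).le)]
  simp only [Function.comp, Pi.div_apply]
  obtain ⟨m, hm⟩ := Nat.exists_eq_add_of_le' hi1
  rw [← sub_eq_add_neg] at hi2 ⊢
  rw [hm, Nat.add_sub_cancel, pow_succ, mul_assoc, mul_assoc, mul_div_assoc]
  congr 1
  have ha0 : (a i : ℂ) ≠ 0 := by
    exact_mod_cast (lt_of_le_of_lt (le_max_right _ _) hi).ne'
  rw [mul_div_cancel_left₀ _ hi2, ← Complex.exp_add]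
  congr 1
  field_simp
  ring

theorem tendsto_expTailIntegral [l.IsCountablyGenerated] {a : ι → ℝ} {x : ι → ℂ} {c : ℝ} {w : ℂ}
    (hn : Tendsto n l atTop) (ha : Tendsto a l atTop)
    (hc : Tendsto (fun i => Real.sqrt (n i) / a i) l (𝓝 c))
    (hx : Tendsto (fun i => (x i - n i) / a i) l (𝓝 w)) (hw : w.re < 0) :
    Tendsto (fun i => expTailIntegral (n i) (a i) (x i)) l
      (𝓝 (∫ t in Ioi (0 : ℝ), Complex.exp (-((c * t : ℂ) ^ 2 / 2) + w * t))) := by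
  refine tendsto_integral_filter_of_dominated_convergence (fun t => Real.exp (w.re / 2 * t))
    ?_ ?_ (integrableOn_exp_mul_Ioi (by linarith) 0) ?_
  · refine Eventually.of_forall fun i => ?_
    exact (Continuous.aestronglyMeasurable (by fun_prop)).indicator measurableSet_Iic
  · have h1 : Tendsto (fun i => ((x i - n i) / a i).re + 1 / a i) l (𝓝 (w.re + 0)) :=
      ((Complex.continuous_re.tendsto _).comp hx).add (tendsto_const_nhds.div_atTop ha)
    have h2 := h1.eventually_le_const (show w.re + 0 < w.re / 2 by linarith)
    filter_upwards [h2, ha.eventually_gt_atTop 0, hn.eventually_ge_atTop 1] with i hi hi0 hi1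
    filter_upwards [ae_restrict_mem measurableSet_Ioi] with t ht
    exact norm_expTail_integrand_le hi1 hi0 ht hi
  · exact Eventually.of_forall fun t => tendsto_expTail_integrand hn ha hc hx t

/-- Convergence of the tail integral on the scale `n`. -/
theorem tendsto_expTailIntegral_natCast [l.IsCountablyGenerated] {ζ : ι → ℂ} {ζ₀ : ℂ}
    (hn : Tendsto n l atTop) (hζ : Tendsto ζ l (𝓝 ζ₀)) (h : ζ₀.re < 1) :
    Tendsto (fun i => expTailIntegral (n i) (n i) (n i * ζ i)) l (𝓝 (1 / (1 - ζ₀))) := by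
  have hR : Tendsto (fun i => (n i : ℝ)) l atTop := tendsto_natCast_atTop_atTop.comp hn
  have hc : Tendsto (fun i => Real.sqrt (n i) / (n i : ℝ)) l (𝓝 0) := by
    refine (tendsto_inv_atTop_zero.comp (Real.tendsto_sqrt_atTop.comp hR)).congr fun i => ?_
    simp only [Function.comp]
    rw [Real.sqrt_div_self', one_div]
  have hx : Tendsto (fun i => ((n i : ℂ) * ζ i - n i) / (n i : ℝ)) l (𝓝 (ζ₀ - 1)) := by
    refine (hζ.sub_const 1).congr' ?_
    filter_upwards [hn.eventually_ge_atTop 1] with i hi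
    have : (n i : ℂ) ≠ 0 := by exact_mod_cast (by omega : n i ≠ 0)
    push_cast
    field_simp
  have hre : (ζ₀ - 1).re < 0 := by simpa using h
  have := tendsto_expTailIntegral hn hR hc hx hre
  simp only [Complex.ofReal_zero, zero_mul, ne_eq, OfNat.ofNat_ne_zero, not_false_eq_true, zero_pow,
    zero_div, neg_zero, zero_add] at this
  rw [integral_exp_mul_complex_Ioi hre] at this
  convert this using 2
  simp only [Complex.ofReal_zero, mul_zero, Complex.exp_zero]
  rw [← neg_sub ζ₀ 1, div_neg, neg_div]

end TailLimits

/-- Continuity of the limit need not be assumed: a joint limit at `x` already keeps `f y` within `ε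
/ 2` of `f x` for `y` near `x`. -/
theorem tendstoLocallyUniformlyOn_of_forall_tendsto_prod {α β : Type*} [TopologicalSpace α]
    [PseudoMetricSpace β] {F : ℕ → α → β} {f : α → β} {s : Set α} (hs : IsOpen s)
    (h : ∀ x ∈ s, Tendsto (fun p : ℕ × α => F p.1 p.2) (atTop ×ˢ 𝓝 x) (𝓝 (f x))) :
    TendstoLocallyUniformlyOn F f atTop s := by
  rw [Metric.tendstoLocallyUniformlyOn_iff]
  intro ε hε x hx
  have h1 : ∀ᶠ p : ℕ × α in atTop ×ˢ 𝓝 x, dist (F p.1 p.2) (f x) < ε / 2 :=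
    (h x hx).eventually (Metric.ball_mem_nhds _ (half_pos hε))
  obtain ⟨P, hP, Q, hQ, hPQ⟩ := eventually_prod_iff.1 h1
  refine ⟨{y | Q y} ∩ s, mem_nhdsWithin_of_mem_nhds (inter_mem hQ (hs.mem_nhds hx)), ?_⟩
  filter_upwards [hP] with m hm y hy
  have h2 : Tendsto (fun k => F k y) atTop (𝓝 (f y)) :=
    (h y hy.2).comp (tendsto_id.prodMk tendsto_const_pure |>.mono_right
      (prod_mono le_rfl (pure_le_nhds y)))
  have h3 : dist (f y) (f x) ≤ ε / 2 :=
    le_of_tendsto (h2.dist tendsto_const_nhds) (hP.mono fun k hk => (hPQ hk hy.1).le)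
  have h4 := hPQ hm hy.1
  rw [dist_comm (f y)] at *
  calc _ ≤ dist (F m y) (f x) + dist (f x) (f y) := dist_triangle _ _ _
    _ < ε := by linarith

/-! ### From sine to the odd part of the exponential sum -/

theorem two_mul_sum_range_odd (m : ℕ) (x : ℂ) :
    expPartialSum (2 * m) x - expPartialSum (2 * m) (-x) =
      2 * ∑ k ∈ Finset.range m, x ^ (2 * k + 1) / ((2 * k + 1).factorial : ℂ) := by
  induction m with
  | zero => simp [expPartialSum]
  | succ m ih =>
    rw [show 2 * (m + 1) = 2 * m + 1 + 1 by ring, Finset.sum_range_succ, mul_add, ← ih]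
    simp only [expPartialSum_succ]
    rw [pow_succ (-x), pow_mul (-x), neg_sq, ← pow_mul]
    ring

theorem expPartialSum_sub_neg (n : ℕ) (x : ℂ) :
    expPartialSum n x - expPartialSum n (-x) =
      2 * ∑ k ∈ Finset.range (n / 2), x ^ (2 * k + 1) / ((2 * k + 1).factorial : ℂ) := by
  rcases Nat.even_or_odd' n with ⟨m, rfl | rfl⟩
  · rw [two_mul_sum_range_odd, Nat.mul_div_cancel_left _ two_pos]
  · rw [show (2 * m + 1) / 2 = m by omega, ← two_mul_sum_range_odd]
    simp only [expPartialSum_succ]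
    rw [pow_mul (-x), neg_sq, ← pow_mul]
    ring

theorem sinPartialSum_mul_I {n : ℕ} (hn : 1 ≤ n) {σ : ℂ} (hσ : σ = 1 ∨ σ = -1) (x : ℂ) :
    sinPartialSum (n - 1) (σ * Complex.I * x) =
      σ * Complex.I / 2 * (expPartialSum n x - expPartialSum n (-x)) := by
  rw [expPartialSum_sub_neg, sinPartialSum, Nat.sub_add_cancel hn, Finset.mul_sum, Finset.mul_sum]
  refine Finset.sum_congr rfl fun k _ => ?_
  have h1 : (σ * Complex.I) ^ 2 = -1 := by
    rcases hσ with rfl | rfl <;> simp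
  rw [mul_pow, pow_succ (σ * Complex.I), pow_mul (σ * Complex.I), h1]
  have : (-1 : ℂ) ^ k * (-1) ^ k = 1 := by rw [← mul_pow]; simp
  linear_combination (σ * Complex.I * x ^ (2 * k + 1) / ((2 * k + 1).factorial : ℂ)) * this

theorem sin_mul_I_eq {σ : ℂ} (hσ : σ = 1 ∨ σ = -1) (x : ℂ) :
    Complex.sin (σ * Complex.I * x) =
      σ * Complex.I / 2 * (Complex.exp x - Complex.exp (-x)) := by
  rw [mul_assoc, mul_comm Complex.I]
  rcases hσ with rfl | rfl
  · rw [one_mul, Complex.sin_mul_I, Complex.sinh]; ring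
  · rw [neg_one_mul, Complex.sin_neg, Complex.sin_mul_I, Complex.sinh]; ring

/-- Numerator and denominator are multiplied by `exp (-x)`. At zeros of the sine both sides are 0 by
the convention for division. -/
theorem sinPartialSum_div_sin {n : ℕ} (hn : 1 ≤ n) {σ : ℂ} (hσ : σ = 1 ∨ σ = -1) (x : ℂ) :
    sinPartialSum (n - 1) (σ * Complex.I * x) / Complex.sin (σ * Complex.I * x) =
      Complex.exp (-x) * (expPartialSum n x - expPartialSum n (-x)) /
        (1 - Complex.exp (-(2 * x))) := by
  rw [sinPartialSum_mul_I hn hσ, sin_mul_I_eq hσ, mul_div_mul_left]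
  · rw [← mul_div_mul_left _ (Complex.exp x - _) (Complex.exp_ne_zero (-x)), mul_sub (Complex.exp (-x)) (Complex.exp x),
      ← Complex.exp_add, ← Complex.exp_add, neg_add_cancel, Complex.exp_zero]
    ring_nf
  · rcases hσ with rfl | rfl <;> simp

/-! ### Gaussian integrals and `erfc` -/

/-- This is `erfc z + erfc (-z) = 2`: reflecting `t` joins the two rays into a horizontal line, over
which the Gaussian integral does not depend on `z`. -/
theorem integral_exp_neg_sq_Ioi_add (z : ℂ) :
    (∫ t in Ioi (0 : ℝ), Complex.exp (-(z - (t : ℂ)) ^ 2)) +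
      ∫ t in Ioi (0 : ℝ), Complex.exp (-(z + (t : ℂ)) ^ 2) = (Real.sqrt Real.pi : ℂ) := by
  have hf : (fun t : ℝ => Complex.exp (-(z + (t : ℂ)) ^ 2)) =
      fun t : ℝ => Complex.exp (-1 * (t : ℂ) ^ 2 + (-(2 * z)) * t + -z ^ 2) := by
    funext t
    congr 1
    ring
  have h1 := integral_cexp_quadratic (b := -1) (by simp) (-(2 * z)) (-z ^ 2)
  have hint : Integrable (fun t : ℝ => Complex.exp (-(z + (t : ℂ)) ^ 2)) := by
    rw [hf]
    exact integrable_cexp_quadratic' (by simp) _ _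
  have h2 : (∫ t in Ioi (0 : ℝ), Complex.exp (-(z - (t : ℂ)) ^ 2)) =
      ∫ t in Iic (0 : ℝ), Complex.exp (-(z + (t : ℂ)) ^ 2) := by
    have := integral_comp_neg_Ioi 0 (fun t : ℝ => Complex.exp (-(z + (t : ℂ)) ^ 2))
    simpa [sub_eq_add_neg] using this
  rw [h2, ← compl_Ioi, add_comm, integral_add_compl measurableSet_Ioi hint, hf, h1, neg_neg, div_one,
    show -z ^ 2 - (-(2 * z)) ^ 2 / (4 * -1) = 0 by ring, Complex.exp_zero, mul_one,
    Real.sqrt_eq_rpow, Complex.ofReal_cpow Real.pi_pos.le]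
  norm_num

/-- Completing the square, the subtracted term is half of `erfc (-w/√2)`. -/
theorem half_mul_complexErfc (w : ℂ) :
    1 - Complex.exp (-(w ^ 2 / 2)) / (Real.sqrt (2 * Real.pi) : ℂ) *
        (∫ t in Ioi (0 : ℝ), Complex.exp (-((t : ℂ) ^ 2 / 2) + w * t)) =
      1 / 2 * complexErfc (w / (Real.sqrt 2 : ℂ)) := by
  have hpi : (Real.sqrt Real.pi : ℂ) ≠ 0 := by
    exact_mod_cast (Real.sqrt_pos.2 Real.pi_pos).ne'
  have h2 : (Real.sqrt 2 : ℂ) ≠ 0 := by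
    exact_mod_cast (Real.sqrt_pos.2 zero_lt_two).ne'
  have h22 : (Real.sqrt 2 : ℂ) ^ 2 = 2 := by
    exact_mod_cast congrArg Complex.ofReal (Real.sq_sqrt zero_le_two)
  have h := integral_exp_neg_sq_Ioi_add (w / (Real.sqrt 2 : ℂ))
  have h3 := integral_comp_mul_left_Ioi
    (fun t : ℝ => Complex.exp (-(w / (Real.sqrt 2 : ℂ) - (t : ℂ)) ^ 2)) 0
    (inv_pos.2 (Real.sqrt_pos.2 zero_lt_two))
  rw [mul_zero, inv_inv, Complex.real_smul] at h3
  have h4 : (∫ t in Ioi (0 : ℝ), Complex.exp (-(w / (Real.sqrt 2 : ℂ) -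
      (((Real.sqrt 2)⁻¹ * t : ℝ) : ℂ)) ^ 2)) = Complex.exp (-(w ^ 2 / 2)) *
        ∫ t in Ioi (0 : ℝ), Complex.exp (-((t : ℂ) ^ 2 / 2) + w * t) := by
    rw [← integral_const_mul]
    refine integral_congr_ae (Eventually.of_forall fun t => ?_)
    simp only []
    rw [← Complex.exp_add]
    congr 1
    push_cast
    field_simp
    rw [h22]
    ring
  rw [h4] at h3
  rw [complexErfc, Real.sqrt_mul zero_le_two]
  push_cast
  generalize (∫ t in Ioi (0 : ℝ), Complex.exp (-((t : ℂ) ^ 2 / 2) + w * t)) = A at h3 ⊢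
  generalize (∫ t in Ioi (0 : ℝ), Complex.exp (-(w / (Real.sqrt 2 : ℂ) + (t : ℂ)) ^ 2)) = B at h ⊢
  field_simp
  linear_combination -h3 - (Real.sqrt 2 : ℂ) * h

/-! ### The normalised odd part and the corner limit -/

section SinhLimits

/-- The odd part of the exponential partial sum, normalised by the exponential. -/
noncomputable def normalizedOddPart (n : ℕ) (x : ℂ) : ℂ :=
  Complex.exp (-x) * (expPartialSum n x - expPartialSum n (-x))

/-- The combination of tail integrals that governs the odd part of the exponential partial sum. -/
noncomputable def oddTail (n : ℕ) (ζ : ℂ) : ℂ :=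
  expTailIntegral n n (n * ζ) - (-1) ^ n * expTailIntegral n n (n * -ζ)

theorem exp_neg_mul_pow_div_factorial (n : ℕ) (ζ : ℂ) :
    Complex.exp (-(n * ζ)) * ((n * ζ) ^ n / (n.factorial : ℂ)) =
      (n : ℂ) ^ n * Complex.exp (-n) / (n.factorial : ℂ) * (ζ * Complex.exp (1 - ζ)) ^ n := by
  have h : Complex.exp (-(n * ζ)) = Complex.exp (-n) * Complex.exp (1 - ζ) ^ n := by
    rw [← Complex.exp_nat_mul, ← Complex.exp_add]
    congr 1
    ring
  rw [h, mul_pow, mul_pow]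
  ring

/-- Only the remainder at `nζ` gets the free scale: when `ζ → 1`, the one at `-nζ` stays far from
its critical point and keeps the scale `n`. -/
theorem normalizedOddPart_eq_of_scale {n : ℕ} (hn : 1 ≤ n) {a : ℝ} (ha : 0 < a) (ζ : ℂ) :
    normalizedOddPart n (n * ζ) = 1 - Complex.exp (-(2 * (n * ζ))) -
      (n : ℂ) ^ n * Complex.exp (-n) / (n.factorial : ℂ) * (ζ * Complex.exp (1 - ζ)) ^ n *
        ((n : ℂ) / a * expTailIntegral n a (n * ζ) -
          (-1) ^ n * expTailIntegral n n (n * -ζ)) := by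
  have hn0 : (0 : ℝ) < n := by exact_mod_cast hn
  have hnc : (n : ℂ) ≠ 0 := by exact_mod_cast hn0.ne'
  have h1 := exp_sub_expPartialSum hn ha (n * ζ)
  have h2 := exp_sub_expPartialSum hn hn0 (n * -ζ)
  rw [Complex.ofReal_natCast, div_self hnc, mul_one, mul_neg, neg_pow] at h2
  rw [← exp_neg_mul_pow_div_factorial, normalizedOddPart, mul_neg]
  have h3 : Complex.exp (-(n * ζ)) * Complex.exp (n * ζ) = 1 := by
    rw [← Complex.exp_add, neg_add_cancel, Complex.exp_zero]
  have h4 : Complex.exp (-(2 * (n * ζ))) = Complex.exp (-(n * ζ)) * Complex.exp (-(n * ζ)) := by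
    rw [← Complex.exp_add]
    congr 1
    ring
  rw [h4]
  linear_combination -Complex.exp (-(n * ζ)) * h1 + Complex.exp (-(n * ζ)) * h2 + h3

theorem normalizedOddPart_eq {n : ℕ} (hn : 1 ≤ n) (ζ : ℂ) :
    normalizedOddPart n (n * ζ) = 1 - Complex.exp (-(2 * (n * ζ))) -
      (n : ℂ) ^ n * Complex.exp (-n) / (n.factorial : ℂ) * (ζ * Complex.exp (1 - ζ)) ^ n *
        oddTail n ζ := by
  have hn0 : (0 : ℝ) < n := by exact_mod_cast hn
  have hnc : (n : ℂ) ≠ 0 := by exact_mod_cast hn0.ne'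
  rw [normalizedOddPart_eq_of_scale hn hn0, oddTail, Complex.ofReal_natCast, div_self hnc, one_mul]

variable {ι : Type*} {l : Filter ι} {n : ι → ℕ}

theorem Filter.Tendsto.neg_one_pow_mul_zero {f : ι → ℂ} (hf : Tendsto f l (𝓝 0)) (n : ι → ℕ) :
    Tendsto (fun i => (-1) ^ n i * f i) l (𝓝 0) := by
  rw [tendsto_zero_iff_norm_tendsto_zero] at hf ⊢
  simpa using hf

/-- Stated as a difference because the sign `(-1)^n` prevents convergence. -/
theorem tendsto_oddTail_sub [l.IsCountablyGenerated] {ζ : ι → ℂ} {ζ₀ : ℂ}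
    (hn : Tendsto n l atTop) (hζ : Tendsto ζ l (𝓝 ζ₀)) (h : |ζ₀.re| < 1) :
    Tendsto (fun i => oddTail (n i) (ζ i) - (1 / (1 - ζ₀) - (-1) ^ n i / (1 + ζ₀))) l (𝓝 0) := by
  have h1 := tendsto_expTailIntegral_natCast hn hζ (abs_lt.1 h).2
  have h2 := tendsto_expTailIntegral_natCast hn hζ.neg
    (by rw [Complex.neg_re]; linarith [(abs_lt.1 h).1])
  rw [sub_neg_eq_add] at h2
  have h3 := (tendsto_sub_nhds_zero_iff.2 h1).sub
    ((tendsto_sub_nhds_zero_iff.2 h2).neg_one_pow_mul_zero n)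
  rw [sub_zero] at h3
  refine h3.congr fun i => ?_
  rw [oddTail]
  ring

theorem tendsto_exp_neg_two_mul {ζ : ι → ℂ} {ζ₀ : ℂ}
    (hn : Tendsto n l atTop) (hζ : Tendsto ζ l (𝓝 ζ₀)) (h : 0 < ζ₀.re) :
    Tendsto (fun i => Complex.exp (-(2 * (n i * ζ i)))) l (𝓝 0) := by
  rw [tendsto_zero_iff_norm_tendsto_zero]
  have h1 : Tendsto (fun i => 2 * ((n i : ℝ) * (ζ i).re)) l atTop :=
    ((tendsto_natCast_atTop_atTop.comp hn).atTop_mul_pos h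
      ((Complex.continuous_re.tendsto _).comp hζ)).const_mul_atTop two_pos
  refine (Real.tendsto_exp_neg_atTop_nhds_zero.comp h1).congr fun i => ?_
  simp [Complex.norm_exp]

theorem tendsto_normalizedOddPart_corner [l.IsCountablyGenerated] {w : ι → ℂ} {w₀ : ℂ}
    (hn : Tendsto n l atTop) (hw : Tendsto w l (𝓝 w₀)) (h : w₀.re < 0) :
    Tendsto (fun i => normalizedOddPart (n i) (n i + w i * (Real.sqrt (n i) : ℂ)) /
      (1 - Complex.exp (-(2 * (n i + w i * (Real.sqrt (n i) : ℂ)))))) l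
      (𝓝 (1 / 2 * complexErfc (w₀ / (Real.sqrt 2 : ℂ)))) := by
  have hR : Tendsto (fun i => (n i : ℝ)) l atTop := tendsto_natCast_atTop_atTop.comp hn
  have ha : Tendsto (fun i => Real.sqrt (n i)) l atTop := Real.tendsto_sqrt_atTop.comp hR
  have hpos : ∀ᶠ i in l, 0 < Real.sqrt (n i) := ha.eventually_gt_atTop 0
  have hsq : ∀ i, (Real.sqrt (n i) : ℂ) * Real.sqrt (n i) = n i := fun i => by
    exact_mod_cast congrArg Complex.ofReal (Real.mul_self_sqrt (Nat.cast_nonneg (n i)))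
  have hv : Tendsto (fun i => (Real.sqrt (n i) : ℂ) * (w i / Real.sqrt (n i))) l (𝓝 w₀) := by
    refine hw.congr' ?_
    filter_upwards [hpos] with i hi
    have : (Real.sqrt (n i) : ℂ) ≠ 0 := by exact_mod_cast hi.ne'
    field_simp
  have hζ := (tendsto_zero_of_sqrt_mul hn hv).const_add 1
  rw [add_zero] at hζ
  have hpow := tendsto_one_add_pow_mul_exp hn hv
  have hst := tendsto_sqrt_mul_pow_div_factorial hn
  have hI : Tendsto (fun i => expTailIntegral (n i) (Real.sqrt (n i))
      (n i * (1 + w i / Real.sqrt (n i)))) l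
      (𝓝 (∫ t in Ioi (0 : ℝ), Complex.exp (-((t : ℂ) ^ 2 / 2) + w₀ * t))) := by
    have := tendsto_expTailIntegral (c := 1) (x := fun i => n i * (1 + w i / Real.sqrt (n i))) hn ha
      (tendsto_const_nhds.congr' ?_) (hw.congr' ?_) h
    · simpa using this
    · filter_upwards [hpos] with i hi
      rw [div_self hi.ne']
    · filter_upwards [hpos] with i hi
      have : (Real.sqrt (n i) : ℂ) ≠ 0 := by exact_mod_cast hi.ne'
      rw [← hsq i]
      field_simp
      ring
  have hJ := tendsto_expTailIntegral_natCast hn hζ.neg (by simp)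
  have hsinv : Tendsto (fun i => (((Real.sqrt (n i))⁻¹ : ℝ) : ℂ)) l (𝓝 0) := by
    exact_mod_cast (Complex.continuous_ofReal.tendsto 0).comp (tendsto_inv_atTop_zero.comp ha)
  have hJ0 := hsinv.mul hJ
  rw [zero_mul] at hJ0
  -- Once `√n` is moved to Stirling's quotient, the integral at `-ζ` carries a factor `1/√n` and
  -- drops out.
  have hJ' := hJ0.neg_one_pow_mul_zero n
  have hE := tendsto_exp_neg_two_mul hn hζ (by simp)
  have hmain := ((hE.const_sub 1).sub ((hst.mul hpow).mul (hI.sub hJ'))).div (hE.const_sub 1)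
    (by simp)
  rw [sub_zero, sub_zero, div_one, one_div_mul_eq_div, half_mul_complexErfc] at hmain
  refine hmain.congr' ?_
  filter_upwards [hpos, hn.eventually_ge_atTop 1] with i hi hi1
  have hs : (Real.sqrt (n i) : ℂ) ≠ 0 := by exact_mod_cast hi.ne'
  have hx : (n i : ℂ) + w i * (Real.sqrt (n i) : ℂ) = n i * (1 + w i / Real.sqrt (n i)) := by
    rw [← hsq i]
    field_simp
  rw [hx, normalizedOddPart_eq_of_scale hi1 hi]
  simp only [Pi.div_apply]
  congr 2
  have hp : ((1 + w i / Real.sqrt (n i)) * Complex.exp (1 - (1 + w i / Real.sqrt (n i)))) ^ n i =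
      (1 + w i / Real.sqrt (n i)) ^ n i * Complex.exp (-(n i * (w i / Real.sqrt (n i)))) := by
    rw [mul_pow, ← Complex.exp_nat_mul]
    congr 2
    ring
  have hd : (n i : ℂ) / Real.sqrt (n i) = Real.sqrt (n i) := by
    nth_rewrite 1 [← hsq i]
    field_simp
  rw [hp, hd]
  push_cast
  field_simp

end SinhLimits

/-! ### The Szegő curve and the arc limit -/

theorem norm_lt_one_of_mem_szegoCurveRight {ξ : ℂ} (hξ : ξ ∈ szegoCurveRight) (h1 : ξ ≠ 1) :
    ‖ξ‖ < 1 := by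
  obtain ⟨h, hle, hre⟩ := hξ
  refine lt_of_le_of_ne hle fun heq => h1 ?_
  rw [norm_mul, heq, one_mul, Complex.norm_exp, Real.exp_eq_one_iff, Complex.sub_re,
    Complex.one_re, sub_eq_zero] at h
  have h2 : ξ.re * ξ.re + ξ.im * ξ.im = 1 := by
    rw [← Complex.normSq_apply, Complex.normSq_eq_norm_sq, heq, one_pow]
  rw [← h] at h2
  apply Complex.ext
  · exact h.symm
  · rw [Complex.one_im]
    nlinarith

/-- The relative displacement of `arcPoint ξ n w` from `ξ`. -/
noncomputable def arcShift (ξ : ℂ) (n : ℕ) (w : ℂ) : ℂ :=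
  (Real.log n : ℂ) / (2 * (1 - ξ) * n) - (w - Complex.I * (arcTauN ξ n : ℂ)) / ((1 - ξ) * n)

theorem arcPoint_eq (ξ : ℂ) (n : ℕ) (w : ℂ) : arcPoint ξ n w = ξ * (1 + arcShift ξ n w) := by
  rw [arcPoint, arcShift]
  ring

theorem norm_arcTauN_le (ξ : ℂ) (n : ℕ) : ‖arcTauN ξ n‖ ≤ Real.pi := by
  have h := toIocMod_mem_Ioc Real.two_pi_pos (-Real.pi) (arcTau ξ * n)
  rw [arcTauN, Real.norm_eq_abs, abs_le]
  exact ⟨h.1.le, by linarith [h.2]⟩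

theorem exp_arcTauN_mul_I (ξ : ℂ) (n : ℕ) :
    Complex.exp (Complex.I * (arcTauN ξ n : ℂ)) = Complex.exp (Complex.I * arcTau ξ) ^ n := by
  have h := toIocMod_add_toIocDiv_zsmul Real.two_pi_pos (-Real.pi) (arcTau ξ * n)
  rw [← arcTauN] at h
  have h2 : arcTauN ξ n = arcTau ξ * n -
      (toIocDiv Real.two_pi_pos (-Real.pi) (arcTau ξ * n) : ℝ) * (2 * Real.pi) := by
    rw [zsmul_eq_mul] at h
    linarith
  rw [← Complex.exp_nat_mul, h2, Complex.exp_eq_exp_iff_exists_int]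
  refine ⟨-toIocDiv Real.two_pi_pos (-Real.pi) (arcTau ξ * n), ?_⟩
  push_cast
  ring

/-- On the curve `log ξ + 1 - ξ` is purely imaginary, with imaginary part `-τ`. -/
theorem mul_exp_one_sub_eq {ξ : ℂ} (hξ : ξ ∈ szegoCurveRight) :
    ξ * Complex.exp (1 - ξ) = Complex.exp (-(Complex.I * arcTau ξ)) := by
  obtain ⟨h, -, hre⟩ := hξ
  have h0 : ξ ≠ 0 := by rintro rfl; simp at hre
  have h1 : ξ * Complex.exp (1 - ξ) = Complex.exp (Complex.log ξ + (1 - ξ)) := by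
    rw [Complex.exp_add, Complex.exp_log h0]
  rw [h1] at h ⊢
  rw [Complex.norm_exp, Real.exp_eq_one_iff] at h
  congr 1
  apply Complex.ext
  · rw [h]
    simp
  · simp [arcTau]
    ring

section ArcLimits

variable {ι : Type*} {l : Filter ι} {n : ι → ℕ}

/-- The shift is `O(log n / n)`, since `τ_n` is bounded. Hence the quadratic correction in `(1 +
v)^n e^(-nv)` disappears. -/
theorem tendsto_sqrt_mul_arcShift {ξ : ℂ} (hξ : ξ ≠ 1) {w : ι → ℂ} {w₀ : ℂ}
    (hn : Tendsto n l atTop) (hw : Tendsto w l (𝓝 w₀)) :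
    Tendsto (fun i => (Real.sqrt (n i) : ℂ) * arcShift ξ (n i) (w i)) l (𝓝 0) := by
  have hR : Tendsto (fun i => (n i : ℝ)) l atTop := tendsto_natCast_atTop_atTop.comp hn
  have ha : Tendsto (fun i => Real.sqrt (n i)) l atTop := Real.tendsto_sqrt_atTop.comp hR
  have hξ' : 1 - ξ ≠ 0 := sub_ne_zero.2 hξ.symm
  have hsinv : Tendsto (fun i => (((Real.sqrt (n i))⁻¹ : ℝ) : ℂ)) l (𝓝 0) := by
    exact_mod_cast (Complex.continuous_ofReal.tendsto 0).comp (tendsto_inv_atTop_zero.comp ha)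
  have hlog : Tendsto (fun i => ((Real.log (n i) / Real.sqrt (n i) : ℝ) : ℂ)) l (𝓝 0) := by
    have h1 : Tendsto (fun x : ℝ => Real.log x / Real.sqrt x) atTop (𝓝 0) := by
      have := (isLittleO_log_rpow_atTop (show (0 : ℝ) < 1 / 2 by norm_num)).tendsto_div_nhds_zero
      simpa only [Real.sqrt_eq_rpow] using this
    exact_mod_cast (Complex.continuous_ofReal.tendsto 0).comp (h1.comp hR)
  have htau : Tendsto (fun i => (((Real.sqrt (n i))⁻¹ : ℝ) : ℂ) * (arcTauN ξ (n i) : ℂ)) l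
      (𝓝 0) := by
    refine hsinv.zero_mul_isBoundedUnder_le ?_
    refine isBoundedUnder_of ⟨Real.pi, fun i => ?_⟩
    simp only [Function.comp, Complex.norm_real]
    exact norm_arcTauN_le _ _
  have hmain := ((hlog.div_const (2 * (1 - ξ))).sub
    (((hw.mul hsinv).sub (htau.const_mul Complex.I)).div_const (1 - ξ)))
  simp only [mul_zero, zero_div, sub_zero] at hmain
  refine hmain.congr' ?_
  filter_upwards [ha.eventually_gt_atTop 0] with i hi
  have hs : (Real.sqrt (n i) : ℂ) ≠ 0 := by exact_mod_cast hi.ne'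
  have hsq : (n i : ℂ) = (Real.sqrt (n i) : ℂ) * Real.sqrt (n i) := by
    exact_mod_cast congrArg Complex.ofReal (Real.mul_self_sqrt (Nat.cast_nonneg (n i))).symm
  rw [arcShift, hsq]
  push_cast
  field_simp

/-- This explains the form of `z_n(w)`: `n (1 - ξ)` times the shift is `(log n)/2 - w + iτ_n`, whose
terms give `√n`, give `e^(-w)`, and cancel the phase of `(ξ e^(1-ξ))^n`. -/
theorem arcPoint_mul_exp_pow {ξ : ℂ} (hξ : ξ ∈ szegoCurveRight) (h1 : ξ ≠ 1) {n : ℕ} (hn : 1 ≤ n)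
    (w : ℂ) : (arcPoint ξ n w * Complex.exp (1 - arcPoint ξ n w)) ^ n =
      (Real.sqrt n : ℂ) * (Complex.exp (-w) *
        ((1 + arcShift ξ n w) ^ n * Complex.exp (-(n * arcShift ξ n w)))) := by
  have hξ' : 1 - ξ ≠ 0 := sub_ne_zero.2 h1.symm
  have hn0 : (0 : ℝ) < n := by exact_mod_cast hn
  have hnc : (n : ℂ) ≠ 0 := by exact_mod_cast hn0.ne'
  have h2 : arcPoint ξ n w * Complex.exp (1 - arcPoint ξ n w) =
      ξ * Complex.exp (1 - ξ) * (1 + arcShift ξ n w) * Complex.exp (-(ξ * arcShift ξ n w)) := by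
    rw [arcPoint_eq, show 1 - ξ * (1 + arcShift ξ n w) = (1 - ξ) + -(ξ * arcShift ξ n w) by ring,
      Complex.exp_add]
    ring
  have h3 : (Real.sqrt n : ℂ) = Complex.exp ((Real.log n : ℂ) / 2) := by
    rw [← Real.exp_log (Real.sqrt_pos.2 hn0), Real.log_sqrt hn0.le]
    push_cast
    rfl
  have h4 : (n : ℂ) * ((1 - ξ) * arcShift ξ n w) =
      (Real.log n : ℂ) / 2 + -w + Complex.I * (arcTauN ξ n : ℂ) := by
    rw [arcShift]
    field_simp
    ring
  have h5 : Complex.exp (-(ξ * arcShift ξ n w)) ^ n =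
      Complex.exp ((n : ℂ) * ((1 - ξ) * arcShift ξ n w)) *
        Complex.exp (-(n * arcShift ξ n w)) := by
    rw [← Complex.exp_nat_mul, ← Complex.exp_add]
    congr 1
    ring
  have h6 : Complex.exp (-(Complex.I * arcTau ξ)) ^ n * Complex.exp (Complex.I * arcTau ξ) ^ n =
      1 := by
    rw [← mul_pow, ← Complex.exp_add, neg_add_cancel, Complex.exp_zero, one_pow]
  rw [h2, mul_pow, mul_pow, mul_exp_one_sub_eq hξ, h5, h4, Complex.exp_add, Complex.exp_add,
    exp_arcTauN_mul_I, ← h3]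
  linear_combination (Real.sqrt n : ℂ) * Complex.exp (-w) * (1 + arcShift ξ n w) ^ n *
    Complex.exp (-(n * arcShift ξ n w)) * h6

theorem tendsto_arcPoint {ξ : ℂ} (h1 : ξ ≠ 1) {w : ι → ℂ} {w₀ : ℂ}
    (hn : Tendsto n l atTop) (hw : Tendsto w l (𝓝 w₀)) :
    Tendsto (fun i => arcPoint ξ (n i) (w i)) l (𝓝 ξ) := by
  have := ((tendsto_zero_of_sqrt_mul hn (tendsto_sqrt_mul_arcShift h1 hn hw)).const_add 1).const_mul
    ξ
  rw [add_zero, mul_one] at this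
  exact this.congr fun i => (arcPoint_eq _ _ _).symm

theorem tendsto_normalizedOddPart_arc [l.IsCountablyGenerated] {ξ : ℂ}
    (hξ : ξ ∈ szegoCurveRight) (h1 : ξ ≠ 1) {w : ι → ℂ} {w₀ : ℂ}
    (hn : Tendsto n l atTop) (hw : Tendsto w l (𝓝 w₀)) :
    Tendsto (fun i => normalizedOddPart (n i) (n i * arcPoint ξ (n i) (w i)) -
      (1 - (1 / (1 - ξ) - (-1) ^ n i / (1 + ξ)) *
        (Complex.exp (-w i) / (Real.sqrt (2 * Real.pi) : ℂ)))) l (𝓝 0) := by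
  have hlt := norm_lt_one_of_mem_szegoCurveRight hξ h1
  have hζ := tendsto_arcPoint h1 hn hw
  have hE := tendsto_exp_neg_two_mul hn hζ hξ.2.2
  have hB := tendsto_oddTail_sub hn hζ ((Complex.abs_re_le_norm ξ).trans_lt hlt)
  have hew := (Complex.continuous_exp.tendsto _).comp hw.neg
  have hp := tendsto_one_add_pow_mul_exp hn (tendsto_sqrt_mul_arcShift h1 hn hw)
  have hst := tendsto_sqrt_mul_pow_div_factorial hn
  have hc := hst.mul (hew.mul hp)
  simp only [ne_eq, OfNat.ofNat_ne_zero, not_false_eq_true, zero_pow, zero_div, neg_zero,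
    Complex.exp_zero, mul_one, one_div_mul_eq_div] at hc
  have hd := hc.sub (hew.div_const (Real.sqrt (2 * Real.pi) : ℂ))
  rw [sub_self] at hd
  have h3 := hd.mul_const (1 / (1 + ξ))
  rw [zero_mul] at h3
  have hmain := (hE.neg.sub (hc.mul hB)).sub
    ((hd.mul_const (1 / (1 - ξ))).sub (h3.neg_one_pow_mul_zero n))
  simp only [neg_zero, mul_zero, zero_mul, sub_zero] at hmain
  refine hmain.congr' ?_
  filter_upwards [hn.eventually_ge_atTop 1] with i hi
  rw [normalizedOddPart_eq hi, arcPoint_mul_exp_pow hξ h1 hi]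
  simp only [Function.comp]
  ring

theorem tendsto_sinPartialSum_div_sin_arc [l.IsCountablyGenerated] {ξ : ℂ}
    (hξ : ξ ∈ szegoCurveRight) (h1 : ξ ≠ 1) {w : ι → ℂ} {w₀ : ℂ}
    (hn : Tendsto n l atTop) (hw : Tendsto w l (𝓝 w₀)) :
    Tendsto (fun i => normalizedOddPart (n i) (n i * arcPoint ξ (n i) (w i)) /
      (1 - Complex.exp (-(2 * (n i * arcPoint ξ (n i) (w i))))) -
      (1 - (1 / (1 - ξ) - (-1) ^ n i / (1 + ξ)) *
        (Complex.exp (-w i) / (Real.sqrt (2 * Real.pi) : ℂ)))) l (𝓝 0) := by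
  have hE := (tendsto_exp_neg_two_mul hn (tendsto_arcPoint h1 hn hw) hξ.2.2).const_sub 1
  rw [sub_zero] at hE
  have hinv := hE.inv₀ one_ne_zero
  have hinv0 := hinv.sub_const 1
  rw [inv_one, sub_self] at hinv0
  have hew := ((Complex.continuous_exp.tendsto _).comp hw.neg).div_const
    (Real.sqrt (2 * Real.pi) : ℂ)
  have h3 := (hew.mul_const (1 / (1 + ξ))).mul hinv0
  rw [mul_zero] at h3
  have hmain := ((tendsto_normalizedOddPart_arc hξ h1 hn hw).mul hinv).add
    ((((hew.mul_const (1 / (1 - ξ))).const_sub 1).mul hinv0).add (h3.neg_one_pow_mul_zero n))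
  simp only [mul_zero, zero_mul, add_zero] at hmain
  refine hmain.congr fun i => ?_
  simp only [Function.comp]
  ring

end ArcLimits

/-! ### Uniform limits on compact sets -/

theorem tendstoUniformlyOn_sinPartialSum_arc {ξ : ℂ} (hξ : ξ ∈ szegoCurveRight) (h1 : ξ ≠ 1)
    {σ : ℂ} (hσ : σ = 1 ∨ σ = -1) {K : Set ℂ} (hK : IsCompact K) :
    TendstoUniformlyOn
      (fun (n : ℕ) (w : ℂ) =>
        sinPartialSum (n - 1) (σ * Complex.I * n * arcPoint ξ n w) /
            Complex.sin (σ * Complex.I * n * arcPoint ξ n w) -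
          (1 - (1 / (1 - ξ) - (-1 : ℂ) ^ n / (1 + ξ)) *
            (Complex.exp (-w) / (Real.sqrt (2 * Real.pi) : ℂ))))
      (fun _ => 0) atTop K := by
  refine (tendstoLocallyUniformlyOn_iff_tendstoUniformlyOn_of_compact hK).1
    (TendstoLocallyUniformlyOn.mono (tendstoLocallyUniformlyOn_of_forall_tendsto_prod isOpen_univ
      fun w₀ _ => ?_) (subset_univ K))
  refine (tendsto_sinPartialSum_div_sin_arc hξ h1 (l := atTop ×ˢ 𝓝 w₀) (n := Prod.fst)
    (w := Prod.snd) tendsto_fst tendsto_snd).congr' ?_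
  filter_upwards [tendsto_fst.eventually_ge_atTop 1] with p hp
  rw [mul_assoc _ (p.1 : ℂ), sinPartialSum_div_sin hp hσ, normalizedOddPart]

theorem tendstoUniformlyOn_sinPartialSum_corner {σ : ℂ} (hσ : σ = 1 ∨ σ = -1) {K : Set ℂ}
    (hK : IsCompact K) (hsub : K ⊆ {w : ℂ | w.re < 0}) :
    TendstoUniformlyOn
      (fun (n : ℕ) (w : ℂ) =>
        sinPartialSum (n - 1) (σ * Complex.I * (n + w * (Real.sqrt n : ℂ))) /
          Complex.sin (σ * Complex.I * (n + w * (Real.sqrt n : ℂ))))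
      (fun w => 1 / 2 * complexErfc (w / (Real.sqrt 2 : ℂ))) atTop K := by
  refine (tendstoLocallyUniformlyOn_iff_tendstoUniformlyOn_of_compact hK).1
    (TendstoLocallyUniformlyOn.mono (tendstoLocallyUniformlyOn_of_forall_tendsto_prod
      (isOpen_lt Complex.continuous_re continuous_const) fun w₀ hw₀ => ?_) hsub)
  refine (tendsto_normalizedOddPart_corner (l := atTop ×ˢ 𝓝 w₀) (n := Prod.fst)
    (w := Prod.snd) tendsto_fst tendsto_snd hw₀).congr' ?_
  filter_upwards [tendsto_fst.eventually_ge_atTop 1] with p hp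
  rw [sinPartialSum_div_sin hp hσ, normalizedOddPart]

/-! ### Zeros lie in the closed unit disc -/

/-- The Eneström–Kakeya estimate for polynomials with increasing positive coefficients. -/
theorem norm_sub_one_mul_sum_sub_le {a : ℕ → ℝ} {w : ℂ} (hw : 1 ≤ ‖w‖) (h0 : 0 ≤ a 0) (N : ℕ)
    (ha : ∀ k < N, a k ≤ a (k + 1)) :
    ‖(w - 1) * ∑ k ∈ Finset.range (N + 1), (a k : ℂ) * w ^ k - a N * w ^ (N + 1)‖ ≤
      a N * ‖w‖ ^ N := by
  induction N with
  | zero =>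
    simp only [zero_add, Finset.sum_range_one, pow_zero, mul_one, pow_one]
    rw [show (w - 1) * (a 0 : ℂ) - a 0 * w = -(a 0 : ℂ) by ring, norm_neg, Complex.norm_real,
      Real.norm_of_nonneg h0]
  | succ N ih =>
    have hN := ha N N.lt_succ_self
    have h := ih fun k hk => ha k (hk.trans N.lt_succ_self)
    rw [Finset.sum_range_succ, show (w - 1) * (∑ k ∈ Finset.range (N + 1), (a k : ℂ) * w ^ k +
        (a (N + 1) : ℂ) * w ^ (N + 1)) - a (N + 1) * w ^ (N + 1 + 1) =
      ((w - 1) * ∑ k ∈ Finset.range (N + 1), (a k : ℂ) * w ^ k - a N * w ^ (N + 1)) -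
        ((a (N + 1) - a N : ℝ) : ℂ) * w ^ (N + 1) by push_cast; ring]
    have h2 : ‖((a (N + 1) - a N : ℝ) : ℂ) * w ^ (N + 1)‖ = (a (N + 1) - a N) * ‖w‖ ^ (N + 1) := by
      rw [norm_mul, norm_pow, Complex.norm_real, Real.norm_of_nonneg (sub_nonneg.2 hN)]
    have h3 : a N * ‖w‖ ^ N ≤ a N * ‖w‖ ^ (N + 1) := by
      have haN : 0 ≤ a N := by
        have := (norm_nonneg _).trans h
        exact nonneg_of_mul_nonneg_left this (by positivity)
      exact mul_le_mul_of_nonneg_left (pow_le_pow_right₀ hw N.le_succ) haN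
    calc _ ≤ _ := norm_sub_le _ _
      _ ≤ a N * ‖w‖ ^ (N + 1) + (a (N + 1) - a N) * ‖w‖ ^ (N + 1) := by
        rw [h2]
        exact add_le_add_left (h.trans h3) _
      _ = _ := by ring

theorem norm_le_one_of_sum_eq_zero {a : ℕ → ℝ} {w : ℂ} (N : ℕ) (h0 : 0 ≤ a 0)
    (ha : ∀ k < N, a k ≤ a (k + 1)) (hN : 0 < a N)
    (h : ∑ k ∈ Finset.range (N + 1), (a k : ℂ) * w ^ k = 0) : ‖w‖ ≤ 1 := by
  by_contra! hw
  have h1 := norm_sub_one_mul_sum_sub_le hw.le h0 N ha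
  rw [h, mul_zero, zero_sub, norm_neg, norm_mul, norm_pow, Complex.norm_real,
    Real.norm_of_nonneg hN.le, pow_succ, ← mul_assoc] at h1
  have h2 : 0 < a N * ‖w‖ ^ N := by positivity
  nlinarith

/-- Divided by `ζ`, the odd part is a polynomial in `ζ²` with coefficients proportional to
`n^(2k+1)/(2k+1)!`; these increase because `(2k+2)(2k+3) ≤ n²` in the range of summation. For `n =
1` the odd part is identically zero. -/
theorem norm_le_one_of_normalizedOddPart_eq_zero {n : ℕ} (hn : 2 ≤ n) {ζ : ℂ}
    (h : normalizedOddPart n (n * ζ) = 0) : ‖ζ‖ ≤ 1 := by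
  rcases eq_or_ne ζ 0 with rfl | hζ
  · simp
  have hn0 : (0 : ℝ) < n := by exact_mod_cast (by omega : 0 < n)
  obtain ⟨N, hN⟩ := Nat.exists_eq_add_of_le' (show 1 ≤ n / 2 by omega)
  rw [normalizedOddPart, mul_eq_zero, or_iff_right (Complex.exp_ne_zero _), expPartialSum_sub_neg,
    hN] at h
  have h2 : ∑ k ∈ Finset.range (N + 1), (((n : ℝ) ^ (2 * k + 1) / ((2 * k + 1).factorial : ℝ) : ℝ)
      : ℂ) * (ζ ^ 2) ^ k = 0 := by
    refine (mul_eq_zero.1 ?_).resolve_left (mul_ne_zero two_ne_zero hζ)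
    rw [← h, mul_assoc, Finset.mul_sum]
    congr 1
    refine Finset.sum_congr rfl fun k _ => ?_
    push_cast
    rw [mul_pow, ← pow_mul]
    ring
  have h3 := norm_le_one_of_sum_eq_zero N (by positivity) (fun k hk => ?_) (by positivity) h2
  · rw [norm_pow] at h3
    exact (sq_le_one_iff₀ (norm_nonneg _)).1 h3
  · have hk1 : ((2 * k + 3 : ℕ) : ℝ) ≤ n := by exact_mod_cast (by omega)
    have hk2 : ((2 * k + 2 : ℕ) : ℝ) ≤ n := by exact_mod_cast (by omega)
    rw [show 2 * (k + 1) + 1 = (2 * k + 1) + 1 + 1 by ring,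
      Nat.factorial_succ (2 * k + 1 + 1), Nat.factorial_succ (2 * k + 1),
      div_le_div_iff₀ (by positivity) (by positivity)]
    push_cast at hk1 hk2 ⊢
    have h4 : ((2 * k + 1 + 1 + 1 : ℝ)) * (2 * k + 1 + 1) ≤ n * n := by
      apply mul_le_mul <;> first | positivity | linarith
    calc (n : ℝ) ^ (2 * k + 1) * ((2 * k + 1 + 1 + 1) * ((2 * k + 1 + 1) * (2 * k + 1).factorial))
        = ((2 * k + 1 + 1 + 1) * (2 * k + 1 + 1)) *
          ((n : ℝ) ^ (2 * k + 1) * (2 * k + 1).factorial) := by ring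
      _ ≤ (n * n) * ((n : ℝ) ^ (2 * k + 1) * (2 * k + 1).factorial) :=
        mul_le_mul_of_nonneg_right h4 (by positivity)
      _ = (n : ℝ) ^ (2 * k + 1 + 1 + 1) * (2 * k + 1).factorial := by ring

/-! ### Zeros accumulate only on the Szegő curve -/

section ZeroLimits

variable {ι : Type*} {l : Filter ι} {n : ι → ℕ}

theorem tendsto_sqrt_mul_pow_zero {y : ι → ℂ} {y₀ : ℂ} (hn : Tendsto n l atTop)
    (hy : Tendsto y l (𝓝 y₀)) (h : ‖y₀‖ < 1) :
    Tendsto (fun i => (Real.sqrt (n i) : ℂ) * y i ^ n i) l (𝓝 0) := by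
  obtain ⟨r, hr, hr1⟩ := exists_between h
  have hr0 : 0 ≤ r := (norm_nonneg _).trans hr.le
  refine squeeze_zero_norm' ?_ ((tendsto_self_mul_const_pow_of_lt_one hr0 hr1).comp hn)
  filter_upwards [hy.norm.eventually_lt_const hr] with i hi
  rw [norm_mul, norm_pow, Complex.norm_real, Real.norm_of_nonneg (Real.sqrt_nonneg _)]
  refine mul_le_mul ?_ (pow_le_pow_left₀ (norm_nonneg _) hi.le _) (by positivity) (by positivity)
  rw [Real.sqrt_le_left (Nat.cast_nonneg _)]
  exact_mod_cast Nat.le_self_pow two_ne_zero _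

theorem tendsto_mul_oddTail_zero [l.IsCountablyGenerated] {ζ f : ι → ℂ} {ζ₀ : ℂ}
    (hn : Tendsto n l atTop) (hζ : Tendsto ζ l (𝓝 ζ₀)) (h : |ζ₀.re| < 1)
    (hf : Tendsto f l (𝓝 0)) : Tendsto (fun i => f i * oddTail (n i) (ζ i)) l (𝓝 0) := by
  have h3 := hf.mul_const (1 / (1 + ζ₀))
  rw [zero_mul] at h3
  have hmain := (hf.mul (tendsto_oddTail_sub hn hζ h)).add
    ((hf.mul_const (1 / (1 - ζ₀))).sub (h3.neg_one_pow_mul_zero n))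
  simp only [zero_mul, sub_zero, add_zero] at hmain
  refine hmain.congr fun i => ?_
  ring

/-- Only two values occur, `2ζ/(1-ζ²)` and `2/(1-ζ²)`, and neither vanishes. -/
theorem exists_pos_le_norm_arc_coefficient {ζ : ℂ} (h0 : ζ ≠ 0) (h1 : 1 - ζ ≠ 0)
    (h2 : 1 + ζ ≠ 0) : ∃ c > 0, ∀ n : ℕ, c ≤ ‖1 / (1 - ζ) - (-1) ^ n / (1 + ζ)‖ := by
  have he : 1 / (1 - ζ) - 1 / (1 + ζ) ≠ 0 := by
    rw [div_sub_div _ _ h1 h2]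
    refine div_ne_zero ?_ (mul_ne_zero h1 h2)
    rw [show 1 * (1 + ζ) - (1 - ζ) * 1 = 2 * ζ by ring]
    exact mul_ne_zero two_ne_zero h0
  have ho : 1 / (1 - ζ) - -1 / (1 + ζ) ≠ 0 := by
    rw [div_sub_div _ _ h1 h2]
    refine div_ne_zero ?_ (mul_ne_zero h1 h2)
    rw [show 1 * (1 + ζ) - (1 - ζ) * -1 = 2 by ring]
    exact two_ne_zero
  refine ⟨min _ _, lt_min (norm_pos_iff.2 he) (norm_pos_iff.2 ho), fun n => ?_⟩
  rcases neg_one_pow_eq_or ℂ n with h | h <;> rw [h]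
  · exact min_le_left _ _
  · exact min_le_right _ _

/-- Otherwise the remainder term and `exp (-2nζ)` both vanish in the limit, and the normalised odd
part tends to 1. -/
theorem not_norm_mul_exp_lt_one_of_zeros [l.IsCountablyGenerated] [l.NeBot] {ζ : ι → ℂ} {ζ₀ : ℂ}
    (hn : Tendsto n l atTop) (hζ : Tendsto ζ l (𝓝 ζ₀)) (h0 : 0 < ζ₀.re) (h1 : ζ₀.re < 1)
    (hz : ∀ᶠ i in l, normalizedOddPart (n i) (n i * ζ i) = 0) :
    ¬ ‖ζ₀ * Complex.exp (1 - ζ₀)‖ < 1 := by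
  intro hX
  have habs : |ζ₀.re| < 1 := abs_lt.2 ⟨by linarith, h1⟩
  have hXt := hζ.mul ((Complex.continuous_exp.tendsto _).comp (hζ.const_sub 1))
  have hR : Tendsto (fun i => (n i : ℝ)) l atTop := tendsto_natCast_atTop_atTop.comp hn
  have hinv : Tendsto (fun i => (((n i : ℝ)⁻¹ : ℝ) : ℂ)) l (𝓝 0) := by
    exact_mod_cast (Complex.continuous_ofReal.tendsto 0).comp (tendsto_inv_atTop_zero.comp hR)
  -- The factor `1/n` offsets the two factors `√n` carried by the limits multiplied here.
  have hf := ((tendsto_sqrt_mul_pow_div_factorial hn).mul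
    (tendsto_sqrt_mul_pow_zero hn hXt hX)).mul hinv
  rw [mul_zero] at hf
  have hlim := ((tendsto_exp_neg_two_mul hn hζ h0).const_sub 1).sub
    (tendsto_mul_oddTail_zero hn hζ habs hf)
  rw [sub_zero, sub_zero] at hlim
  refine one_ne_zero (tendsto_nhds_unique hlim (tendsto_const_nhds.congr' ?_))
  filter_upwards [hz, hn.eventually_ge_atTop 1] with i hi hi1
  rw [normalizedOddPart_eq hi1] at hi
  rw [← hi]
  have hnc : (n i : ℂ) ≠ 0 := by exact_mod_cast (by omega : n i ≠ 0)
  have hsq : (Real.sqrt (n i) : ℂ) ^ 2 = n i := by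
    exact_mod_cast congrArg Complex.ofReal (Real.sq_sqrt (Nat.cast_nonneg (n i)))
  simp only [Function.comp]
  push_cast
  field_simp
  rw [hsq]
  ring

/-- Solving the vanishing equation for `oddTail` would make it tend to 0, whereas it approaches
coefficients bounded away from 0. -/
theorem not_one_lt_norm_mul_exp_of_zeros [l.IsCountablyGenerated] [l.NeBot] {ζ : ι → ℂ} {ζ₀ : ℂ}
    (hn : Tendsto n l atTop) (hζ : Tendsto ζ l (𝓝 ζ₀)) (h0 : 0 < ζ₀.re) (h1 : ζ₀.re < 1)
    (hz : ∀ᶠ i in l, normalizedOddPart (n i) (n i * ζ i) = 0) :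
    ¬ 1 < ‖ζ₀ * Complex.exp (1 - ζ₀)‖ := by
  intro hX
  have habs : |ζ₀.re| < 1 := abs_lt.2 ⟨by linarith, h1⟩
  have hX0 : ζ₀ * Complex.exp (1 - ζ₀) ≠ 0 := norm_pos_iff.1 (zero_lt_one.trans hX)
  have hXt := hζ.mul ((Complex.continuous_exp.tendsto _).comp (hζ.const_sub 1))
  have hY := tendsto_sqrt_mul_pow_zero hn (hXt.inv₀ hX0) (by rw [norm_inv]; exact inv_lt_one_of_one_lt₀ hX)
  have hst := tendsto_sqrt_mul_pow_div_factorial hn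
  have hpi : (Real.sqrt (2 * Real.pi) : ℂ) ≠ 0 := by
    exact_mod_cast (Real.sqrt_pos.2 (by positivity)).ne'
  have hdiv := (hY.mul ((tendsto_exp_neg_two_mul hn hζ h0).const_sub 1)).div hst
    (one_div_ne_zero hpi)
  rw [zero_mul, zero_div] at hdiv
  have hT : Tendsto (fun i => oddTail (n i) (ζ i)) l (𝓝 0) := by
    refine hdiv.congr' ?_
    filter_upwards [hz, hn.eventually_ge_atTop 1, hXt.eventually_ne hX0] with i hi hi1 hi2
    rw [normalizedOddPart_eq hi1, sub_eq_zero] at hi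
    simp only [Function.comp, Pi.div_apply] at hi2 ⊢
    rw [hi]
    have hnc : (n i : ℂ) ≠ 0 := by exact_mod_cast (by omega : n i ≠ 0)
    have hs : (Real.sqrt (n i) : ℂ) ≠ 0 := by
      exact_mod_cast (Real.sqrt_pos.2 (by exact_mod_cast hi1 : (0 : ℝ) < n i)).ne'
    have hfac : ((n i).factorial : ℂ) ≠ 0 := by exact_mod_cast (n i).factorial_ne_zero
    have hp := pow_ne_zero (n i) hi2
    have hp2 := pow_ne_zero (n i) hnc
    have he := Complex.exp_ne_zero (-(n i : ℂ))
    generalize ζ i * Complex.exp (1 - ζ i) = X at hp ⊢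
    rw [inv_pow]
    field_simp
  obtain ⟨c, hc, hcb⟩ := exists_pos_le_norm_arc_coefficient (ζ := ζ₀)
    (by rintro rfl; simp at h0)
    (fun h => by have := congrArg Complex.re h; simp at this; linarith)
    (fun h => by have := congrArg Complex.re h; simp at this; linarith)
  have hb := (hT.sub (tendsto_oddTail_sub hn hζ habs)).norm
  simp only [sub_sub_cancel, sub_self, norm_zero] at hb
  exact absurd (ge_of_tendsto' hb fun i => hcb (n i)) (not_le.2 hc)

theorem mem_szegoCurveRight_of_zeros [l.IsCountablyGenerated] [l.NeBot] {ζ : ι → ℂ} {ζ₀ : ℂ}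
    (hn : Tendsto n l atTop) (hζ : Tendsto ζ l (𝓝 ζ₀)) (h0 : 0 < ζ₀.re)
    (hz : ∀ᶠ i in l, normalizedOddPart (n i) (n i * ζ i) = 0) : ζ₀ ∈ szegoCurveRight := by
  have hle : ‖ζ₀‖ ≤ 1 := by
    refine le_of_tendsto hζ.norm ?_
    filter_upwards [hz, hn.eventually_ge_atTop 2] with i hi hi2
    exact norm_le_one_of_normalizedOddPart_eq_zero hi2 hi
  have hre : ζ₀.re ≤ 1 := (Complex.re_le_norm ζ₀).trans hle
  rcases hre.lt_or_eq with h1 | h1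
  · exact ⟨le_antisymm (not_lt.1 (not_one_lt_norm_mul_exp_of_zeros hn hζ h0 h1 hz))
      (not_lt.1 (not_norm_mul_exp_lt_one_of_zeros hn hζ h0 h1 hz)), hle, h0⟩
  -- The tail limits require `Re ζ₀ < 1`; when `Re ζ₀ = 1`, the bound `‖ζ₀‖ ≤ 1` settles the matter
  -- directly.
  · refine ⟨?_, hle, h0⟩
    rw [norm_mul, Complex.norm_exp, Complex.sub_re, h1, Complex.one_re, sub_self, Real.exp_zero,
      mul_one]
    exact le_antisymm hle (h1 ▸ Complex.re_le_norm ζ₀)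

end ZeroLimits

/-! ### Existence of zeros near the curve -/

/-- Hurwitz's theorem at a zero of a limit of entire functions. -/
theorem eventually_exists_zero_of_tendstoUniformlyOn {F : ℕ → ℂ → ℂ} {h : ℂ → ℂ} {w₀ : ℂ}
    (hF : ∀ m, Differentiable ℂ (F m)) (hh : Differentiable ℂ h) (h0 : h w₀ = 0)
    (hne : ∀ᶠ w in 𝓝[≠] w₀, h w ≠ 0)
    (hlim : ∀ r, TendstoUniformlyOn F h atTop (Metric.closedBall w₀ r)) {ε : ℝ} (hε : 0 < ε) :
    ∀ᶠ m in atTop, ∃ w, F m w = 0 ∧ dist w w₀ < ε := by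
  rw [eventually_nhdsWithin_iff, Metric.eventually_nhds_iff] at hne
  obtain ⟨δ, hδ, hδh⟩ := hne
  obtain ⟨r, hr0, hr⟩ := exists_between (lt_min hε hδ)
  have hrne : ∀ z ∈ Metric.sphere w₀ r, h z ≠ 0 := fun z hz => by
    rw [Metric.mem_sphere] at hz
    refine hδh (hz ▸ hr.trans_le (min_le_right _ _)) fun he => ?_
    rw [mem_singleton_iff.1 he, dist_self] at hz
    exact hr0.ne hz
  obtain ⟨z₁, hz₁, hmin⟩ := (isCompact_sphere w₀ r).exists_isMinOn
    (NormedSpace.sphere_nonempty.2 hr0.le) (hh.continuous.norm.continuousOn)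
  have hM : 0 < ‖h z₁‖ := norm_pos_iff.2 (hrne z₁ hz₁)
  -- With `M` the minimum of `‖h‖` on the circle, an error below `M/4` gives `‖F z - F w₀‖ ≥ M/2`
  -- there. The quantitative open mapping theorem then covers the disc of radius `M/4` about `F w₀`,
  -- which contains 0.
  filter_upwards [Metric.tendstoUniformlyOn_iff.1 (hlim r) (‖h z₁‖ / 4) (by positivity)] with m hm
  have hw₀ : ‖F m w₀‖ < ‖h z₁‖ / 4 := by
    have := hm w₀ (Metric.mem_closedBall_self hr0.le)
    rwa [h0, dist_zero_left] at this
  have hsph : ∀ z ∈ Metric.sphere w₀ r, ‖h z₁‖ / 2 ≤ ‖F m z - F m w₀‖ := fun z hz => by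
    have h1 := hm z (Metric.sphere_subset_closedBall hz)
    have h2 : ‖h z₁‖ ≤ ‖h z‖ := hmin hz
    rw [dist_eq_norm] at h1
    have h3 : ‖h z‖ ≤ ‖h z - F m z‖ + ‖F m z - F m w₀‖ + ‖F m w₀‖ := by
      calc ‖h z‖ = ‖(h z - F m z) + (F m z - F m w₀) + F m w₀‖ := by congr 1; ring
        _ ≤ _ := norm_add₃_le
    linarith
  have hfreq : ∃ᶠ z in 𝓝 w₀, F m z ≠ F m w₀ := by
    intro hconst
    have h1 := AnalyticOnNhd.eq_of_eventuallyEq (f := F m) (g := fun _ => F m w₀) (z₀ := w₀)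
      (fun z _ => (hF m).analyticAt z) (fun z _ => analyticAt_const)
      (hconst.mono fun z hz => not_not.1 hz)
    have h2 := hsph z₁ hz₁
    rw [h1, sub_self, norm_zero] at h2
    linarith
  obtain ⟨w, hw, hw0⟩ := ((hF m).diffContOnCl.ball_subset_image_closedBall hr0 hsph hfreq)
    (show (0 : ℂ) ∈ Metric.ball (F m w₀) (‖h z₁‖ / 2 / 2) by
      rw [Metric.mem_ball, dist_zero_left]; linarith)
  exact ⟨w, hw0, (Metric.mem_closedBall.1 hw).trans_lt (hr.trans_le (min_le_left _ _))⟩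

theorem differentiable_normalizedOddPart_arcPoint (ξ : ℂ) (n : ℕ) :
    Differentiable ℂ fun w => normalizedOddPart n (n * arcPoint ξ n w) := by
  unfold normalizedOddPart expPartialSum arcPoint
  fun_prop

/-- Even indices suffice for infinitely many `n` and freeze the sign `(-1)^n`, so a true limit `1 -
b e^(-w)` exists, with zero `log b`. -/
theorem exists_zeros_near_arc {ξ : ℂ} (hξ : ξ ∈ szegoCurveRight) (h1 : ξ ≠ 1) {ε : ℝ}
    (hε : 0 < ε) :
    ∀ᶠ m : ℕ in atTop, ∃ ζ, normalizedOddPart (2 * m) ((2 * m : ℕ) * ζ) = 0 ∧ dist ζ ξ < ε := by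
  have hre := hξ.2.2
  have hlt := (Complex.re_le_norm ξ).trans_lt (norm_lt_one_of_mem_szegoCurveRight hξ h1)
  obtain ⟨c, hc, hcb⟩ := exists_pos_le_norm_arc_coefficient (ζ := ξ)
    (by rintro rfl; simp at hre)
    (fun h => by have := congrArg Complex.re h; simp at this; linarith)
    (fun h => by have := congrArg Complex.re h; simp at this; linarith)
  have hb0 : 1 / (1 - ξ) - 1 / (1 + ξ) ≠ 0 := by
    have := hcb 0
    rw [pow_zero] at this
    exact norm_pos_iff.1 (hc.trans_le this)
  have hpi : (Real.sqrt (2 * Real.pi) : ℂ) ≠ 0 := by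
    exact_mod_cast (Real.sqrt_pos.2 (by positivity)).ne'
  set b := (1 / (1 - ξ) - 1 / (1 + ξ)) / (Real.sqrt (2 * Real.pi) : ℂ) with hb
  have hbne : b ≠ 0 := div_ne_zero hb0 hpi
  have hdiff : Differentiable ℂ fun w : ℂ => 1 - b * Complex.exp (-w) := by fun_prop
  have h0 : 1 - b * Complex.exp (-Complex.log b) = 0 := by
    rw [Complex.exp_neg, Complex.exp_log hbne, mul_inv_cancel₀ hbne, sub_self]
  have hderiv : HasDerivAt (fun w : ℂ => 1 - b * Complex.exp (-w)) 1 (Complex.log b) := by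
    have h : HasDerivAt (fun w : ℂ => 1 - b * Complex.exp (-w))
        (-(b * (Complex.exp (-Complex.log b) * -1))) (Complex.log b) :=
      (((hasDerivAt_neg (Complex.log b)).cexp).const_mul b).const_sub 1
    rwa [show -(b * (Complex.exp (-Complex.log b) * -1)) = 1 by linear_combination -h0] at h
  have hne := hderiv.eventually_ne one_ne_zero (c := 0)
  have htwo : Tendsto (fun m : ℕ => 2 * m) atTop atTop :=
    tendsto_id.const_mul_atTop' two_pos
  have hlim : ∀ r, TendstoUniformlyOn
      (fun (m : ℕ) w => normalizedOddPart (2 * m) ((2 * m : ℕ) * arcPoint ξ (2 * m) w))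
      (fun w => 1 - b * Complex.exp (-w)) atTop (Metric.closedBall (Complex.log b) r) := fun r => by
    refine (tendstoLocallyUniformlyOn_iff_tendstoUniformlyOn_of_compact
      (isCompact_closedBall _ _)).1
      (TendstoLocallyUniformlyOn.mono (tendstoLocallyUniformlyOn_of_forall_tendsto_prod isOpen_univ
        fun w₀ _ => ?_) (subset_univ _))
    have hlim := (tendsto_normalizedOddPart_arc hξ h1 (l := atTop ×ˢ 𝓝 w₀)
      (n := fun p : ℕ × ℂ => 2 * p.1) (w := Prod.snd) (htwo.comp tendsto_fst) tendsto_snd).add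
      ((hdiff.continuous.tendsto w₀).comp tendsto_snd)
    rw [zero_add] at hlim
    refine hlim.congr fun p => ?_
    simp only [Function.comp, pow_mul, neg_one_sq, one_pow, hb]
    ring
  have hclose : ∀ᶠ p : ℕ × ℂ in atTop ×ˢ 𝓝 (Complex.log b),
      dist (arcPoint ξ (2 * p.1) p.2) ξ < ε :=
    (tendsto_arcPoint h1 (n := fun p : ℕ × ℂ => 2 * p.1) (w := Prod.snd)
      (htwo.comp tendsto_fst) tendsto_snd).eventually (Metric.ball_mem_nhds _ hε)
  obtain ⟨P, hP, Q, hQ, hPQ⟩ := eventually_prod_iff.1 hclose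
  obtain ⟨δ, hδ, hδQ⟩ := Metric.eventually_nhds_iff.1 hQ
  filter_upwards [hP, eventually_exists_zero_of_tendstoUniformlyOn
    (fun m => differentiable_normalizedOddPart_arcPoint ξ (2 * m)) hdiff h0 hne hlim hδ]
    with m hm ⟨w, hw, hwδ⟩
  exact ⟨arcPoint ξ (2 * m) w, hw, hPQ hm (hδQ hwδ)⟩

/-- A point of modulus `r` lies on the curve when its real part is `1 + log r`; as `log r ≤ r - 1`,
such a point exists for `r` just below 1. -/
theorem exists_mem_szegoCurveRight_near_one {ε : ℝ} (hε : 0 < ε) :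
    ∃ ξ ∈ szegoCurveRight, ξ ≠ 1 ∧ dist ξ 1 < ε := by
  let f : ℝ → ℂ := fun r => ((1 + Real.log r : ℝ) : ℂ) +
    (Real.sqrt (r ^ 2 - (1 + Real.log r) ^ 2) : ℂ) * Complex.I
  have hf1 : f 1 = 1 := by simp [f]
  have hlog : ContinuousAt Real.log 1 := Real.continuousAt_log one_ne_zero
  have hf : ContinuousAt f 1 := by
    refine (Complex.continuous_ofReal.continuousAt.comp (hlog.const_add 1)).add
      ((Complex.continuous_ofReal.continuousAt.comp (Real.continuous_sqrt.continuousAt.comp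
        ((continuousAt_id.pow 2).sub ((hlog.const_add 1).pow 2)))).mul continuousAt_const)
  have h1 : ∀ᶠ r in 𝓝[<] (1 : ℝ), dist (f r) 1 < ε := by
    have : ∀ᶠ r in 𝓝 (1 : ℝ), dist (f r) (f 1) < ε := hf.eventually (Metric.ball_mem_nhds _ hε)
    rw [hf1] at this
    exact eventually_nhdsWithin_of_eventually_nhds this
  have h2 : ∀ᶠ r in 𝓝[<] (1 : ℝ), 0 < 1 + Real.log r := by
    have : ∀ᶠ r in 𝓝 (1 : ℝ), 0 < 1 + Real.log r :=
      (hlog.const_add 1).eventually (lt_mem_nhds (by simp))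
    exact eventually_nhdsWithin_of_eventually_nhds this
  have h3 : ∀ᶠ r in 𝓝[<] (1 : ℝ), 0 < r :=
    eventually_nhdsWithin_of_eventually_nhds (lt_mem_nhds zero_lt_one)
  obtain ⟨r, hr1, hr2, hr3, hr4⟩ := (h1.and (h2.and (h3.and self_mem_nhdsWithin))).exists
  have hle : 1 + Real.log r ≤ r := by linarith [Real.log_le_sub_one_of_pos hr3]
  have hre : (f r).re = 1 + Real.log r := by simp [f]
  have him : (f r).im = Real.sqrt (r ^ 2 - (1 + Real.log r) ^ 2) := by simp [f]
  have hnorm : ‖f r‖ = r := by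
    rw [Complex.norm_eq_sqrt_sq_add_sq, hre, him, Real.sq_sqrt (by nlinarith), add_sub_cancel,
      Real.sqrt_sq hr3.le]
  refine ⟨f r, ⟨?_, hnorm.trans_le (le_of_lt hr4), by rwa [hre]⟩, fun h => ?_, hr1⟩
  · rw [norm_mul, Complex.norm_exp, hnorm, Complex.sub_re, hre, Complex.one_re,
      show 1 - (1 + Real.log r) = -Real.log r by ring, Real.exp_neg, Real.exp_log hr3,
      mul_inv_cancel₀ hr3.ne']
  · rw [h, norm_one] at hnorm
    exact absurd hr4 (by rw [← hnorm]; exact lt_irrefl _)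

/-! ### Limit points of the zeros of the sine sums -/

theorem sinPartialSum_mul_I_eq_zero_iff {n : ℕ} (hn : 1 ≤ n) {σ : ℂ} (hσ : σ = 1 ∨ σ = -1)
    (ζ : ℂ) : sinPartialSum (n - 1) (n * (σ * Complex.I * ζ)) = 0 ↔
      normalizedOddPart n (n * ζ) = 0 := by
  rw [mul_left_comm, sinPartialSum_mul_I hn hσ, normalizedOddPart, mul_eq_zero, mul_eq_zero,
    or_iff_right (Complex.exp_ne_zero _), or_iff_right]
  rcases hσ with rfl | rfl <;> simp

theorem isLimitPointOfZeros_of_mem_szegoCurveRight {σ : ℂ} (hσ : σ = 1 ∨ σ = -1) {ξ : ℂ}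
    (hξ : ξ ∈ szegoCurveRight) :
    IsLimitPointOfZeros (fun n z => sinPartialSum (n - 1) (n * z)) (σ * Complex.I * ξ) := by
  intro ε hε
  -- The arc argument excludes `ξ = 1`, which is reached as a limit of other points of the curve.
  obtain ⟨ξ', hξ', hne, hd⟩ : ∃ ξ' ∈ szegoCurveRight, ξ' ≠ 1 ∧ dist ξ' ξ < ε / 2 := by
    rcases eq_or_ne ξ 1 with rfl | h
    · exact exists_mem_szegoCurveRight_near_one (half_pos hε)
    · exact ⟨ξ, hξ, h, by rw [dist_self]; exact half_pos hε⟩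
  have htwo : Tendsto (fun m : ℕ => 2 * m) atTop atTop :=
    tendsto_id.const_mul_atTop' two_pos
  refine htwo.frequently (Eventually.frequently ?_)
  filter_upwards [exists_zeros_near_arc hξ' hne (half_pos hε), eventually_ge_atTop 1]
    with m ⟨ζ, hζ, hζd⟩ hm
  refine ⟨σ * Complex.I * ζ, (sinPartialSum_mul_I_eq_zero_iff (by omega) hσ ζ).2 hζ, ?_⟩
  have hnorm : ‖σ * Complex.I‖ = 1 := by rcases hσ with rfl | rfl <;> simp
  rw [dist_eq_norm, ← mul_sub, norm_mul, hnorm, one_mul, ← dist_eq_norm]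
  exact (dist_triangle ζ ξ' ξ).trans_lt (by linarith)

theorem mem_szegoCurveRight_of_isLimitPointOfZeros {σ : ℂ} (hσ : σ = 1 ∨ σ = -1) {ζ₀ : ℂ}
    (h0 : 0 < ζ₀.re)
    (h : IsLimitPointOfZeros (fun n z => sinPartialSum (n - 1) (n * z)) (σ * Complex.I * ζ₀)) :
    ζ₀ ∈ szegoCurveRight := by
  have hnorm : ‖σ * Complex.I‖ = 1 := by rcases hσ with rfl | rfl <;> simp
  have hne : σ * Complex.I ≠ 0 := norm_pos_iff.1 (hnorm ▸ zero_lt_one)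
  -- Accumulation of zeros says that the zero set meets this product filter, so restricting the
  -- filter to it leaves a proper filter along which every point is a zero.
  have hfreq : ∃ᶠ p : ℕ × ℂ in atTop ×ˢ 𝓝 ζ₀,
      p ∈ {p : ℕ × ℂ | normalizedOddPart p.1 (p.1 * p.2) = 0} := by
    intro hev
    obtain ⟨P, hP, Q, hQ, hPQ⟩ := eventually_prod_iff.1 hev
    obtain ⟨δ, hδ, hδQ⟩ := Metric.eventually_nhds_iff.1 hQ
    obtain ⟨n, ⟨z, hz, hzd⟩, hnP, hn⟩ :=
      ((h δ hδ).and_eventually (hP.and (eventually_ge_atTop 1))).exists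
    have hzeq : z = σ * Complex.I * ((σ * Complex.I)⁻¹ * z) := by
      rw [mul_inv_cancel_left₀ hne]
    rw [hzeq, dist_eq_norm, ← mul_sub, norm_mul, hnorm, one_mul, ← dist_eq_norm] at hzd
    simp only at hz
    rw [hzeq, sinPartialSum_mul_I_eq_zero_iff hn hσ] at hz
    exact hPQ hnP (hδQ hzd) hz
  have := frequently_mem_iff_neBot.1 hfreq
  exact mem_szegoCurveRight_of_zeros
    (l := (atTop ×ˢ 𝓝 ζ₀) ⊓ 𝓟 {p : ℕ × ℂ | normalizedOddPart p.1 (p.1 * p.2) = 0})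
    (n := Prod.fst) (ζ := Prod.snd) (tendsto_fst.mono_left inf_le_left)
    (tendsto_snd.mono_left inf_le_left) h0 (mem_inf_of_right (mem_principal_self _))

theorem setOf_isLimitPointOfZeros_sinPartialSum :
    {z : ℂ | IsLimitPointOfZeros (fun n z => sinPartialSum (n - 1) (n * z)) z ∧ z.im ≠ 0} =
      (fun ξ : ℂ => Complex.I * ξ) '' szegoCurveRight ∪
        (fun ξ : ℂ => -(Complex.I * ξ)) '' szegoCurveRight := by
  have hpos : ∀ ξ : ℂ, 1 * Complex.I * ξ = Complex.I * ξ := fun ξ => by ring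
  have hneg : ∀ ξ : ℂ, -1 * Complex.I * ξ = -(Complex.I * ξ) := fun ξ => by ring
  ext z
  constructor
  · rintro ⟨hz, him⟩
    rcases him.lt_or_gt with h | h
    · have hzeq : -(Complex.I * (Complex.I * z)) = z := by
        rw [← mul_assoc, Complex.I_mul_I, neg_one_mul, neg_neg]
      refine Or.inr ⟨Complex.I * z, mem_szegoCurveRight_of_isLimitPointOfZeros (Or.inr rfl)
        (by simpa using h) ?_, hzeq⟩
      rwa [hneg, hzeq]
    · have hzeq : Complex.I * (-(Complex.I * z)) = z := by
        rw [mul_neg, ← mul_assoc, Complex.I_mul_I, neg_one_mul, neg_neg]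
      refine Or.inl ⟨-(Complex.I * z), mem_szegoCurveRight_of_isLimitPointOfZeros (Or.inl rfl)
        (by simpa using h) ?_, hzeq⟩
      rwa [hpos, hzeq]
  · rintro (⟨ξ, hξ, rfl⟩ | ⟨ξ, hξ, rfl⟩)
    · have := isLimitPointOfZeros_of_mem_szegoCurveRight (Or.inl rfl) hξ
      rw [hpos] at this
      exact ⟨this, by simpa using hξ.2.2.ne'⟩
    · have := isLimitPointOfZeros_of_mem_szegoCurveRight (Or.inr rfl) hξ
      rw [hneg] at this
      exact ⟨this, by simpa using hξ.2.2.ne'⟩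

theorem mainTheorem10 :
    -- the non-real limit points of the zeros of `p_{n-1}[sin](n z)` are exactly `iS ∪ -iS`
    ({z : ℂ | IsLimitPointOfZeros (fun n z => sinPartialSum (n - 1) (n * z)) z ∧ z.im ≠ 0} =
      (fun ξ : ℂ => Complex.I * ξ) '' szegoCurveRight ∪
        (fun ξ : ℂ => -(Complex.I * ξ)) '' szegoCurveRight) ∧
    -- the scaling limit at the arcs, for both signs `σ = ±1`
    (∀ ξ ∈ szegoCurveRight, ξ ≠ 1 → ∀ σ : ℂ, (σ = 1 ∨ σ = -1) →
      ∀ K : Set ℂ, IsCompact K →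
        TendstoUniformlyOn
          (fun (n : ℕ) (w : ℂ) =>
            sinPartialSum (n - 1) (σ * Complex.I * n * arcPoint ξ n w) /
                Complex.sin (σ * Complex.I * n * arcPoint ξ n w) -
              (1 - (1 / (1 - ξ) - (-1 : ℂ) ^ n / (1 + ξ)) *
                (Complex.exp (-w) / (Real.sqrt (2 * Real.pi) : ℂ))))
          (fun _ => 0) Filter.atTop K) ∧
    -- the scaling limit at the corners, for both signs `σ = ±1`
    (∀ σ : ℂ, (σ = 1 ∨ σ = -1) →
      ∀ K : Set ℂ, IsCompact K → K ⊆ {w : ℂ | w.re < 0} →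
        TendstoUniformlyOn
          (fun (n : ℕ) (w : ℂ) =>
            sinPartialSum (n - 1) (σ * Complex.I * (n + w * (Real.sqrt n : ℂ))) /
              Complex.sin (σ * Complex.I * (n + w * (Real.sqrt n : ℂ))))
          (fun w => 1 / 2 * complexErfc (w / (Real.sqrt 2 : ℂ))) Filter.atTop K) := by
  exact ⟨setOf_isLimitPointOfZeros_sinPartialSum,
    fun _ hξ h1 _ hσ _ hK => tendstoUniformlyOn_sinPartialSum_arc hξ h1 hσ hK,
    fun _ hσ _ hK hsub => tendstoUniformlyOn_sinPartialSum_corner hσ hK hsub⟩
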